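/- Consider a relativistic charged fluid in Minkowski spacetime with metric $g=\mathrm{diag}(-1,1,1,1)$, described by fields $(\epsilon,n,u^\mu)$ with $u_\mu u^\mu=-1$, an equation of state given by $C^1$ functions $P,T,\mu$ of $(\epsilon,n)$, and continuous transport coefficients $\zeta,\eta,\sigma,\sigma_0,\tau_\epsilon,\tau_Q,\tau_P,\tau_n,\tau_J$ depending on $(\epsilon,n)$. Put $\rho=\epsilon+P$, $\Delta^{\mu\nu}=g^{\mu\nu}+u^\mu u^\nu$, $V=\zeta+\tfrac43\eta$, and write $P_\epsilon,P_n$ and $\alpha_\epsilon,\alpha_n$ for the partial derivatives of $P$ and of $\alpha=\mu/T$. Let $$\lambda_x=-\sigma_0T\alpha_x+\tau_J\tfrac n\rho P_x,\qquad \beta_x=\sigma T\tfrac\rho n\alpha_x+\tau_QP_x\qquad(x=\epsilon,n),$$ $$c_s^2=P_\epsilon+\tfrac n\rho P_n,\qquad s_2=T(\alpha_nP_\epsilon-\alpha_\epsilon P_n),\qquad D=(\rho\tau_P-V)(\beta_n\lambda_\epsilon-\beta_\epsilon\lambda_n).$$ The evolution equations are $\partial_\mu T^{\mu\nu}=0$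 and $\partial_\mu J^\mu=0$, where $$T^{\mu\nu}=(\epsilon+\mathcal A)u^\mu u^\nu+(P+\Pi)\Delta^{\mu\nu}+u^\mu Q^\nu+u^\nu Q^\mu-2\eta\sigma^{\mu\nu},\qquad J^\mu=(n+N)u^\mu+\mathcal J^\mu,$$ $$\mathcal A=\tau_\epsilon[u^\lambda\partial_\lambda\epsilon+\rho\,\partial_\lambda u^\lambda],\quad \Pi=-\zeta\,\partial_\lambda u^\lambda+\tau_P[u^\lambda\partial_\lambda\epsilon+\rho\,\partial_\lambda u^\lambda],\quad N=\tau_n[n\,\partial_\lambda u^\lambda+u^\lambda\partial_\lambda n],$$ $$Q^\mu=\tau_Q\rho\,u^\lambda\partial_\lambda u^\mu+\beta_\epsilon\Delta^{\mu\lambda}\partial_\lambda\epsilon+\beta_n\Delta^{\mu\lambda}\partial_\lambda n,\quad \mathcal J^\mu=\tau_Jn\,u^\lambda\partial_\lambda u^\mu+\lambda_\epsilon\Delta^{\mu\lambda}\partial_\lambda\epsilon+\lambda_n\Delta^{\mu\lambda}\partial_\lambda n,$$ and $\sigma^{\mu\nu}=(\Delta^{\mu(\alpha}\Delta^{\beta)\nu}-\tfrac13\Delta^{\mu\nu}\Delta^{\alpha\beta})\partial_\alpha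 u_\beta$. Fix a homogeneous equilibrium $(\epsilon,n)$, $u^\mu=(1,0,0,0)$, with $n>0$, $T>0$, $\rho>0$; all coefficients below are evaluated at it. For $k\ge 0$ let $P_{\rm sound}(\Gamma,k)=\sum_{i=0}^6a_i\Gamma^i$, where $$\begin{aligned} a_6&=\rho\tau_n\tau_Q\tau_\epsilon,\qquad a_5=\rho(\tau_n\tau_Q+\tau_n\tau_\epsilon+\tau_Q\tau_\epsilon),\\ a_4&=\rho(\tau_Q+\tau_n+\tau_\epsilon)+[V\tau_n\tau_\epsilon+\tau_n\tau_\epsilon(n\beta_n+\rho\beta_\epsilon)+\rho\tau_Q(\tau_n\tau_P-\lambda_n\tau_\epsilon)+n\tau_J\tau_\epsilon\beta_n]k^2,\\ a_3&=\rho+[V(\tau_n+\tau_\epsilon)+\tau_n\tau_\epsilon\rho c_s^2+n(\beta_n(\tau_\epsilon+\tau_n+\tau_J)+\tau_JP_n\tau_\epsilon)\\&\quad+\rho(-\lambda_n\tau_Q+P_\epsilon\tau_Q\tau_n+\tau_Q\tau_P+\beta_\epsilon\tau_\epsilon-\lambda_n\tau_\epsilon)]k^2,\\ a_2&=[V+n(\beta_n+P_n(\tau_n+\tau_\epsilon+\tau_J))+\rho(-\lambda_n+P_\epsilon(\tau_n+\tau_Q+\tau_\epsilon))]k^2\\&\quad+[-V(\beta_\epsilon\tau_n+\lambda_n\tau_\epsilon)+n\beta_n(\tau_J+\tau_n)\tau_P+\rho((\beta_n\lambda_\epsilon-\beta_\epsilon\lambda_n)\tau_\epsilon+(\beta_\epsilon\tau_n-\lambda_n\tau_Q)\tau_P)]k^4,\\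 a_1&=\rho c_s^2k^2+[-V(\lambda_n+\beta_\epsilon)+(\rho\beta_\epsilon+n\beta_n)\tau_P+n\tau_n(\beta_nP_\epsilon-\beta_\epsilon P_n)\\&\quad+\rho(\lambda_\epsilon P_n-\lambda_nP_\epsilon)(\tau_Q+\tau_\epsilon)-n\tau_J(P_n\beta_\epsilon-P_\epsilon\beta_n)]k^4,\\ a_0&=[n(\beta_nP_\epsilon-\beta_\epsilon P_n)-\rho(\lambda_nP_\epsilon-\lambda_\epsilon P_n)]k^4+(\rho\tau_P-V)(\beta_n\lambda_\epsilon-\beta_\epsilon\lambda_n)k^6, \end{aligned}$$ and let $H_i(k)$ be the upper-left $i\times i$ block of the $6\times6$ Hurwitz matrix whose rows are $(a_5,a_3,a_1,0,0,0)$, $(a_6,a_4,a_2,a_0,0,0)$ and their shifts to the right by one and by two places. Assume $\sigma+\sigma_0\ge0$, $\eta\ge0$, $D\ge0$, $s_2>0$, $c_s^2\ge0$, $\tau_n,\tau_\epsilon,\tau_Q>0$, and $\det H_i(k)\ge0$ for $i=2,3,4,5$ and all $k\ge0$. Then the evolution equations are linearly stable around this equilibrium: if, for some $k\in\mathbb R^3$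 and $\Gamma\in\mathbb C$, a plane wave $e^{\Gamma t+ik\cdot x}(\delta\epsilon_0,\delta n_0,\delta u_0^\mu)$ with nonzero complex amplitude and $u_\mu\delta u_0^\mu=0$ solves the equations linearised at the equilibrium, then $\operatorname{Re}\Gamma\le0$. Moreover, let $\mathcal S(\Gamma,k)$ be the $5\times 5$ matrix of the linearised equations on plane waves, acting on $(\delta\epsilon,\delta n,\delta u^j)$ (with $k^2=|k|^2$), $$\mathcal S=\begin{pmatrix}-\lambda_\epsilon k^2&\tau_n\Gamma^2+\Gamma-\lambda_nk^2&in[1+(\tau_n+\tau_J)\Gamma]k_j\\ \tau_\epsilon\Gamma^2+\Gamma-\beta_\epsilon k^2&-\beta_nk^2&i\rho[1+(\tau_\epsilon+\tau_Q)\Gamma]k_j\\ i[P_\epsilon+(\tau_P+\beta_\epsilon)\Gamma]k^i&i[P_n+\beta_n\Gamma]k^i&[\zeta+\tfrac13\eta-\tau_P\rho]k^ik_j+[\rho\tau_Q\Gamma^2+\rho\Gamma+\eta k^2]\delta^i_j\end{pmatrix}.$$ Then $\det\mathcal S(\Gamma,k)=-P_{\rm shear}(\Gamma,|k|)^2P_{\rm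 sound}(\Gamma,|k|)$ with $P_{\rm shear}(\Gamma,k)=\rho\tau_Q\Gamma^2+\rho\Gamma+\eta k^2$, and $a_0=(\sigma+\sigma_0)\rho s_2k^4+Dk^6\ge0$. -/

import Mathlib

/-! First-order (BDNK) relativistic charged fluid in Minkowski spacetime: equation of state,
constitutive relations, conservation laws, linearisation around a uniform state at rest,
plane-wave stability, and the dispersion determinant with its Hurwitz matrices. -/

/-- Equation of state and transport coefficients of the fluid, as functions of the pair
`(ε, n)` (energy density, charge density). -/
structure FluidModel where
  /-- pressure -/
  P : ℝ × ℝ → ℝ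
  /-- temperature -/
  T : ℝ × ℝ → ℝ
  /-- chemical potential -/
  μ : ℝ × ℝ → ℝ
  /-- bulk viscosity -/
  ζ : ℝ × ℝ → ℝ
  /-- shear viscosity -/
  η : ℝ × ℝ → ℝ
  /-- heat conductivity parameter -/
  σ : ℝ × ℝ → ℝ
  /-- charge diffusivity -/
  σ₀ : ℝ × ℝ → ℝ
  τε : ℝ × ℝ → ℝ
  τQ : ℝ × ℝ → ℝ
  τP : ℝ × ℝ → ℝ
  τn : ℝ × ℝ → ℝ
  τJ : ℝ × ℝ → ℝ

/-- Partial derivative with respect to `ε` at constant `n`. -/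
noncomputable def dEps (f : ℝ × ℝ → ℝ) (p : ℝ × ℝ) : ℝ := fderiv ℝ f p (1, 0)

/-- Partial derivative with respect to `n` at constant `ε`. -/
noncomputable def dNum (f : ℝ × ℝ → ℝ) (p : ℝ × ℝ) : ℝ := fderiv ℝ f p (0, 1)

namespace FluidModel

/-- `ρ = ε + P`. -/
def ρ (M : FluidModel) (p : ℝ × ℝ) : ℝ := p.1 + M.P p

/-- `μ / T`. -/
noncomputable def α (M : FluidModel) (p : ℝ × ℝ) : ℝ := M.μ p / M.T p

noncomputable def lamε (M : FluidModel) (p : ℝ × ℝ) : ℝ :=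
  -M.σ₀ p * M.T p * dEps M.α p + M.τJ p * (p.2 / M.ρ p) * dEps M.P p

noncomputable def lamn (M : FluidModel) (p : ℝ × ℝ) : ℝ :=
  -M.σ₀ p * M.T p * dNum M.α p + M.τJ p * (p.2 / M.ρ p) * dNum M.P p

noncomputable def βε (M : FluidModel) (p : ℝ × ℝ) : ℝ :=
  M.σ p * M.T p * (M.ρ p / p.2) * dEps M.α p + M.τQ p * dEps M.P p

noncomputable def βn (M : FluidModel) (p : ℝ × ℝ) : ℝ :=
  M.σ p * M.T p * (M.ρ p / p.2) * dNum M.α p + M.τQ p * dNum M.P p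

/-- `V = ζ + 4 η / 3`. -/
noncomputable def V (M : FluidModel) (p : ℝ × ℝ) : ℝ := M.ζ p + 4 / 3 * M.η p

noncomputable def D (M : FluidModel) (p : ℝ × ℝ) : ℝ :=
  (M.ρ p * M.τP p - M.V p) * (M.βn p * M.lamε p - M.βε p * M.lamn p)

noncomputable def s₂ (M : FluidModel) (p : ℝ × ℝ) : ℝ :=
  M.T p * (dNum M.α p * dEps M.P p - dEps M.α p * dNum M.P p)

/-- Square of the adiabatic speed of sound of the ideal fluid. -/
noncomputable def csSq (M : FluidModel) (p : ℝ × ℝ) : ℝ :=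
  dEps M.P p + p.2 / M.ρ p * dNum M.P p

/-- Regularity at a state: the equation of state is `C¹` near it and the transport
coefficients are continuous at it. -/
structure RegularAt (M : FluidModel) (p : ℝ × ℝ) : Prop where
  P : ContDiffAt ℝ 1 M.P p
  T : ContDiffAt ℝ 1 M.T p
  μ : ContDiffAt ℝ 1 M.μ p
  ζ : ContinuousAt M.ζ p
  η : ContinuousAt M.η p
  σ : ContinuousAt M.σ p
  σ₀ : ContinuousAt M.σ₀ p
  τε : ContinuousAt M.τε p
  τQ : ContinuousAt M.τQ p
  τP : ContinuousAt M.τP p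
  τn : ContinuousAt M.τn p
  τJ : ContinuousAt M.τJ p

end FluidModel

/-- Minkowski spacetime with inertial coordinates `(t, x, y, z)`, indexed by `0, 1, 2, 3`. -/
abbrev Spacetime := Fin 4 → ℝ

/-- The metric `diag(-1,1,1,1)`; the same matrix has lower and upper indices. -/
def minkowski : Matrix (Fin 4) (Fin 4) ℝ := Matrix.diagonal ![-1, 1, 1, 1]

/-- `∂_a f`. -/
noncomputable def pd (a : Fin 4) (f : Spacetime → ℝ) (x : Spacetime) : ℝ :=
  fderiv ℝ f x (Pi.single a 1)

/-- Fluid variables `(ε, n, u^μ)` as fields on spacetime (also used for perturbations). -/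
structure FluidFields where
  ε : Spacetime → ℝ
  n : Spacetime → ℝ
  u : Spacetime → Fin 4 → ℝ

namespace FluidFields

/-- The thermodynamic state `(ε, n)` at a point. -/
def st (q : FluidFields) (x : Spacetime) : ℝ × ℝ := (q.ε x, q.n x)

/-- The projector `Δ^{ab} = g^{ab} + u^a u^b`. -/
def proj (q : FluidFields) (x : Spacetime) (a b : Fin 4) : ℝ :=
  minkowski a b + q.u x a * q.u x b

/-- `u_a`. -/
def uLow (q : FluidFields) (a : Fin 4) (x : Spacetime) : ℝ := ∑ b, minkowski a b * q.u x b

/-- The derivative `u^a ∂_a f` along the flow. -/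
noncomputable def along (q : FluidFields) (f : Spacetime → ℝ) (x : Spacetime) : ℝ :=
  ∑ a, q.u x a * pd a f x

/-- The projected gradient `Δ^{ab} ∂_b f`. -/
noncomputable def pgrad (q : FluidFields) (f : Spacetime → ℝ) (x : Spacetime) (a : Fin 4) : ℝ :=
  ∑ b, q.proj x a b * pd b f x

/-- The expansion `∂_a u^a`. -/
noncomputable def divU (q : FluidFields) (x : Spacetime) : ℝ :=
  ∑ a, pd a (fun y => q.u y a) x

/-- The shear tensor
`σ^{ab} = (Δ^{a(c} Δ^{d)b} - Δ^{ab} Δ^{cd} / 3) ∂_c u_d`. -/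
noncomputable def shear (q : FluidFields) (x : Spacetime) (a b : Fin 4) : ℝ :=
  ∑ c, ∑ d, ((q.proj x a c * q.proj x d b + q.proj x a d * q.proj x c b) / 2
    - 1 / 3 * q.proj x a b * q.proj x c d) * pd c (q.uLow d) x

/-- The fields `q + s δq`. -/
def perturb (q δq : FluidFields) (s : ℝ) : FluidFields where
  ε := fun x => q.ε x + s * δq.ε x
  n := fun x => q.n x + s * δq.n x
  u := fun x a => q.u x a + s * δq.u x a

/-- The homogeneous configuration at rest, `u = (1,0,0,0)`. -/
def rest (p : ℝ × ℝ) : FluidFields where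
  ε := fun _ => p.1
  n := fun _ => p.2
  u := fun _ => Pi.single 0 1

end FluidFields

namespace FluidModel

/-! First-order constitutive relations. -/

noncomputable def calA (M : FluidModel) (q : FluidFields) (x : Spacetime) : ℝ :=
  M.τε (q.st x) * (q.along q.ε x + M.ρ (q.st x) * q.divU x)

noncomputable def calPi (M : FluidModel) (q : FluidFields) (x : Spacetime) : ℝ :=
  -M.ζ (q.st x) * q.divU x
    + M.τP (q.st x) * (q.along q.ε x + M.ρ (q.st x) * q.divU x)

noncomputable def calQ (M : FluidModel) (q : FluidFields) (x : Spacetime) (a : Fin 4) : ℝ :=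
  M.τQ (q.st x) * M.ρ (q.st x) * q.along (fun y => q.u y a) x
    + M.βε (q.st x) * q.pgrad q.ε x a + M.βn (q.st x) * q.pgrad q.n x a

noncomputable def calN (M : FluidModel) (q : FluidFields) (x : Spacetime) : ℝ :=
  M.τn (q.st x) * (q.n x * q.divU x + q.along q.n x)

noncomputable def calJ (M : FluidModel) (q : FluidFields) (x : Spacetime) (a : Fin 4) : ℝ :=
  M.τJ (q.st x) * q.n x * q.along (fun y => q.u y a) x
    + M.lamε (q.st x) * q.pgrad q.ε x a + M.lamn (q.st x) * q.pgrad q.n x a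

/-- The stress-energy tensor
`T^{ab} = (ε + 𝒜) u^a u^b + (P + Π) Δ^{ab} + u^a Q^b + u^b Q^a - 2 η σ^{ab}`. -/
noncomputable def stress (M : FluidModel) (q : FluidFields) (x : Spacetime) (a b : Fin 4) : ℝ :=
  (q.ε x + M.calA q x) * q.u x a * q.u x b
    + (M.P (q.st x) + M.calPi q x) * q.proj x a b
    + q.u x a * M.calQ q x b + q.u x b * M.calQ q x a
    - 2 * M.η (q.st x) * q.shear x a b

/-- The charge current `J^a = (n + N) u^a + 𝒥^a`. -/
noncomputable def current (M : FluidModel) (q : FluidFields) (x : Spacetime) (a : Fin 4) : ℝ :=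
  (q.n x + M.calN q x) * q.u x a + M.calJ q x a

/-- First-order variation of the stress-energy tensor at `q` in the direction `δq`. -/
noncomputable def δstress (M : FluidModel) (q δq : FluidFields) (a b : Fin 4)
    (x : Spacetime) : ℝ :=
  deriv (fun s : ℝ => M.stress (q.perturb δq s) x a b) 0

/-- First-order variation of the charge current at `q` in the direction `δq`. -/
noncomputable def δcurrent (M : FluidModel) (q δq : FluidFields) (a : Fin 4)
    (x : Spacetime) : ℝ :=
  deriv (fun s : ℝ => M.current (q.perturb δq s) x a) 0

/-- `δq` is a (`C²`) solution of the evolution equations `∂_a J^a = 0`, `∂_a T^{ab} = 0`,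
linearised at `q`, and satisfies the linearised normalisation `u_a δu^a = 0`. -/
structure IsLinearisedSolution (M : FluidModel) (q δq : FluidFields) : Prop where
  smooth_ε : ContDiff ℝ 2 δq.ε
  smooth_n : ContDiff ℝ 2 δq.n
  smooth_u : ContDiff ℝ 2 δq.u
  normalised : ∀ x, ∑ a, q.uLow a x * δq.u x a = 0
  charge : ∀ x, ∑ a, pd a (M.δcurrent q δq a) x = 0
  energy_momentum : ∀ x b, ∑ a, pd a (M.δstress q δq a b) x = 0

end FluidModel

/-- Amplitude `(δε₀, δn₀, δu₀^a)` of a plane wave. -/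
abbrev Amplitude := ℂ × ℂ × (Fin 4 → ℂ)

/-- The factor `exp(Γ t + i k·x)`. -/
noncomputable def phase (Γ : ℂ) (k : Fin 3 → ℝ) (x : Spacetime) : ℂ :=
  Complex.exp (Γ * (x 0 : ℂ) + Complex.I * ((∑ i : Fin 3, k i * x i.succ : ℝ) : ℂ))

/-- Real part of the plane wave `exp(Γ t + i k·x) δq₀`. -/
noncomputable def waveRe (A : Amplitude) (Γ : ℂ) (k : Fin 3 → ℝ) : FluidFields where
  ε := fun x => (phase Γ k x * A.1).re
  n := fun x => (phase Γ k x * A.2.1).re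
  u := fun x a => (phase Γ k x * A.2.2 a).re

/-- Imaginary part of the plane wave `exp(Γ t + i k·x) δq₀`. -/
noncomputable def waveIm (A : Amplitude) (Γ : ℂ) (k : Fin 3 → ℝ) : FluidFields where
  ε := fun x => (phase Γ k x * A.1).im
  n := fun x => (phase Γ k x * A.2.1).im
  u := fun x a => (phase Γ k x * A.2.2 a).im

namespace FluidModel

/-- A complex plane wave solves the linearised (real) equations around the uniform state `p`
at rest iff its real and imaginary parts do. -/
def IsMode (M : FluidModel) (p : ℝ × ℝ) (A : Amplitude) (Γ : ℂ) (k : Fin 3 → ℝ) : Prop :=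
  M.IsLinearisedSolution (FluidFields.rest p) (waveRe A Γ k) ∧
    M.IsLinearisedSolution (FluidFields.rest p) (waveIm A Γ k)

/-- Linear stability of the uniform state `p` at rest: no nontrivial plane-wave solution of the
linearised equations, of any wave vector, grows in time. -/
def LinearlyStable (M : FluidModel) (p : ℝ × ℝ) : Prop :=
  ∀ (k : Fin 3 → ℝ) (Γ : ℂ) (A : Amplitude), A ≠ 0 → M.IsMode p A Γ k → Γ.re ≤ 0

/-- The matrix of the linearised equations on plane waves, acting on `(δε, δn, δu^1, δu^2, δu^3)`;
rows: charge, energy, momentum. -/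
noncomputable def dispersionMatrix (M : FluidModel) (p : ℝ × ℝ) (Γ : ℂ) (k : Fin 3 → ℝ) :
    Matrix (Fin 5) (Fin 5) ℂ :=
  let kk : ℂ := ((∑ i, k i ^ 2 : ℝ) : ℂ)
  let jcol : Fin 3 → ℂ := fun j => Complex.I * p.2 * (1 + (M.τn p + M.τJ p) * Γ) * k j
  let ecol : Fin 3 → ℂ := fun j => Complex.I * M.ρ p * (1 + (M.τε p + M.τQ p) * Γ) * k j
  let εrow : Fin 3 → ℂ := fun i => Complex.I * (dEps M.P p + (M.τP p + M.βε p) * Γ) * k i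
  let nrow : Fin 3 → ℂ := fun i => Complex.I * (dNum M.P p + M.βn p * Γ) * k i
  let B : Fin 3 → Fin 3 → ℂ := fun i j =>
    (M.ζ p + 1 / 3 * M.η p - M.τP p * M.ρ p) * k i * k j
      + if i = j then M.ρ p * M.τQ p * Γ ^ 2 + M.ρ p * Γ + M.η p * kk else 0
  !![-M.lamε p * kk, M.τn p * Γ ^ 2 + Γ - M.lamn p * kk, jcol 0, jcol 1, jcol 2;
     M.τε p * Γ ^ 2 + Γ - M.βε p * kk, -M.βn p * kk, ecol 0, ecol 1, ecol 2;
     εrow 0, nrow 0, B 0 0, B 0 1, B 0 2;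
     εrow 1, nrow 1, B 1 0, B 1 1, B 1 2;
     εrow 2, nrow 2, B 2 0, B 2 1, B 2 2]

/-- The shear polynomial `ρ τ_Q Γ² + ρ Γ + η k²`. -/
noncomputable def shearPoly (M : FluidModel) (p : ℝ × ℝ) (Γ : ℂ) (k : ℝ) : ℂ :=
  M.ρ p * M.τQ p * Γ ^ 2 + M.ρ p * Γ + M.η p * k ^ 2

/-- The coefficients `a₀, …, a₆` of the sound polynomial, as functions of `k`. -/
noncomputable def a (M : FluidModel) (p : ℝ × ℝ) (k : ℝ) : Fin 7 → ℝ :=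
  let n := p.2
  let ρ := M.ρ p
  let V := M.V p
  let Pε := dEps M.P p
  let Pn := dNum M.P p
  let le := M.lamε p
  let ln := M.lamn p
  let be := M.βε p
  let bn := M.βn p
  let τε := M.τε p
  let τQ := M.τQ p
  let τP := M.τP p
  let τn := M.τn p
  let τJ := M.τJ p
  ![(n * (bn * Pε - be * Pn) - ρ * (ln * Pε - le * Pn)) * k ^ 4
      + (ρ * τP - V) * (bn * le - be * ln) * k ^ 6,
    ρ * M.csSq p * k ^ 2
      + (-V * (ln + be) + (ρ * be + n * bn) * τP + n * τn * (bn * Pε - be * Pn)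
        + ρ * (-ln * Pε + le * Pn) * (τQ + τε) - n * τJ * (Pn * be - Pε * bn)) * k ^ 4,
    (V + n * (bn + Pn * (τn + τε + τJ)) + ρ * (-ln + Pε * (τn + τQ + τε))) * k ^ 2
      + (-V * (be * τn + ln * τε) + n * bn * (τJ + τn) * τP
        + ρ * ((bn * le - be * ln) * τε + (be * τn - ln * τQ) * τP)) * k ^ 4,
    ρ + (V * (τn + τε) + τn * τε * ρ * M.csSq p
        + n * (bn * (τε + τn + τJ) + τJ * Pn * τε)
        + ρ * (-ln * τQ + Pε * τQ * τn + τQ * τP + be * τε - ln * τε)) * k ^ 2,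
    ρ * (τQ + τn + τε) + (V * τn * τε + τn * τε * (n * bn + ρ * be)
        + ρ * τQ * (τn * τP - ln * τε) + n * τJ * τε * bn) * k ^ 2,
    ρ * (τn * τQ + τn * τε + τQ * τε),
    ρ * τn * τQ * τε]

/-- The sound polynomial `∑ aᵢ Γ^i`. -/
noncomputable def soundPoly (M : FluidModel) (p : ℝ × ℝ) (Γ : ℂ) (k : ℝ) : ℂ :=
  ∑ i : Fin 7, (M.a p k i : ℂ) * Γ ^ (i : ℕ)

/-- The Hurwitz matrix of the sound polynomial. -/
noncomputable def hurwitz (M : FluidModel) (p : ℝ × ℝ) (k : ℝ) : Matrix (Fin 6) (Fin 6) ℝ :=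
  let a := M.a p k
  !![a 5, a 3, a 1, 0, 0, 0;
     a 6, a 4, a 2, a 0, 0, 0;
     0, a 5, a 3, a 1, 0, 0;
     0, a 6, a 4, a 2, a 0, 0;
     0, 0, a 5, a 3, a 1, 0;
     0, 0, a 6, a 4, a 2, a 0]

/-- The upper-left `m × m` submatrix `H_m` of the Hurwitz matrix. -/
noncomputable def H (M : FluidModel) (p : ℝ × ℝ) (k : ℝ) (m : ℕ) (hm : m ≤ 6) :
    Matrix (Fin m) (Fin m) ℝ :=
  (M.hurwitz p k).submatrix (Fin.castLE hm) (Fin.castLE hm)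

end FluidModel

/-! A mode's amplitude is a kernel vector of the dispersion matrix, so stability is a question about
the zeros of a determinant. Rotation covariance factors it (`det_scalar_vector_block`,
`det_dispersionMatrix`). The shear factor is a quadratic with coefficients of one sign; the
difficulty lies in the sound sextic.

Weak inequalities on Hurwitz minors do not confine the roots of a single polynomial. Here, however,
the coefficients are polynomials in `K = k ^ 2`, and the second and third minors are positive at `K
= 0`. Immediately to the right of any `K ≥ 0` both are therefore strictly positive, and
`hurwitz_six` applies there even if the fourth or fifth minor vanishes, provided `a1 ≥ 0` whenever
`h4 = a0 = 0`. If `h4` vanishes identically, so does `a0`; the minor identity then says that the odd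
and even parts of the remaining quintic share a root, which with `c_s² ≥ 0` forces `a1 ≥ 0`
(`const_nonneg_of_common_root`). The bound of `norm_le_of_roots_re_nonpos` is uniform in `K` and
carries the conclusion back to the original `K` (`re_nonpos_of_hurwitz_family`).

Linearisation needs no differentiability of the transport coefficients: each multiplies an
expression vanishing in equilibrium. The linearised fluxes are real-linear in the first-order jet,
hence commute with real part, imaginary part and multiplication by the phase, which turns the field
equations into the matrix equation (`IsMode.dispersionMatrix_mulVec`). -/

/-! ### Weak Routh–Hurwitz criterion for sextics and for polynomial families of them -/

open Filter Topology Polynomial in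
/-- A nonzero polynomial does not vanish immediately to the right of a point. -/
theorem Polynomial.eventually_eval_ne_zero_right {F : ℝ[X]} (hF : F ≠ 0) (x : ℝ) :
    ∀ᶠ y in 𝓝[>] x, F.eval y ≠ 0 := by
  have h : ∀ᶠ y in 𝓝[≠] x, y ∉ (F.rootSet ℝ \ {x}) := by
    have hfin : (F.rootSet ℝ \ {x}).Finite := (F.rootSet_finite ℝ).subset Set.sdiff_subset
    exact mem_nhdsWithin_of_mem_nhds (hfin.isClosed.isOpen_compl.mem_nhds (by simp))
  have h' : ∀ᶠ y in 𝓝[>] x, y ∉ (F.rootSet ℝ \ {x}) :=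
    h.filter_mono (nhdsWithin_mono _ fun y hy => ne_of_gt hy)
  filter_upwards [h', self_mem_nhdsWithin] with y hy hxy h0
  exact hy ⟨by simp [Polynomial.mem_rootSet, hF, h0], ne_of_gt hxy⟩

open ComplexConjugate in
/-- One step of the Routh division chain preserves the sign of `Re (f * conj g)`. -/
theorem routh_step {c : ℝ} {z f g : ℂ} (hc : 0 ≤ c) (hz : 0 ≤ z.re)
    (h : 0 ≤ (g * conj f).re) : 0 ≤ (f * conj (c * z * f + g)).re := by
  have key : (f * conj (c * z * f + g)).re = c * z.re * Complex.normSq f + (g * conj f).re := by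
    simp [Complex.normSq_apply]; ring
  rw [key]
  have := Complex.normSq_nonneg f
  positivity

/-- A vanishing imaginary part makes `z` real, and then the value is positive. This closes the Routh
chain at its last nonzero row. -/
theorem sq_mul_add_ne_zero {r s : ℝ} {z : ℂ} (hr : 0 < r) (hs : 0 ≤ s) (hz : 0 < z.re) :
    (r : ℂ) * z ^ 2 + s ≠ 0 := by
  intro h
  have h1 := congrArg Complex.re h
  have h2 := congrArg Complex.im h
  simp [pow_two] at h1 h2
  have h3 : z.im = 0 := by
    have := h2.resolve_left hr.ne'
    have : 2 * z.re * z.im = 0 := by linarith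
    exact (mul_eq_zero.1 this).resolve_left (by positivity)
  rw [h3] at h1
  have : 0 < r * (z.re * z.re) := by positivity
  linarith

open ComplexConjugate in
/-- Routh's criterion in degree six, allowing a vanishing row: `b`, `c`, `d` are the rows of the
Routh table. -/
theorem routh_six {a0 a1 a2 a3 a4 a5 a6 b4 b2 c3 c1 d2 : ℝ}
    (h6 : 0 < a6) (h5 : 0 < a5) (hb : 0 < b4) (hc : 0 < c3) (hd : 0 ≤ d2) (h0 : 0 ≤ a0)
    (hb4 : b4 = a4 - a6 / a5 * a3) (hb2 : b2 = a2 - a6 / a5 * a1)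
    (hc3 : c3 = a3 - a5 / b4 * b2) (hc1 : c1 = a1 - a5 / b4 * a0)
    (hd2 : d2 = b2 - b4 / c3 * c1) (he : 0 ≤ c1 * d2 - c3 * a0) (hd0 : d2 = 0 → 0 ≤ c1)
    {z : ℂ} (hz : 0 < z.re)
    (hroot : (a0 : ℂ) + a1 * z + a2 * z ^ 2 + a3 * z ^ 3 + a4 * z ^ 4 + a5 * z ^ 5 + a6 * z ^ 6
      = 0) : False := by
  -- `f0` and `f1` are the even and odd parts of the sextic; the others are successive remainders,
  -- each division having quotient a nonnegative constant times `z`.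
  set f4 : ℂ := d2 * z ^ 2 + a0 with hf4
  set f3 : ℂ := c3 * z ^ 3 + c1 * z with hf3
  set f2 : ℂ := b4 * z ^ 4 + b2 * z ^ 2 + a0 with hf2
  set f1 : ℂ := a5 * z ^ 5 + a3 * z ^ 3 + a1 * z with hf1
  set f0 : ℂ := a6 * z ^ 6 + a4 * z ^ 4 + a2 * z ^ 2 + a0 with hf0
  have e0 : f0 = (a6 / a5 : ℝ) * z * f1 + f2 := by
    have h5' : (a5 : ℂ) ≠ 0 := by exact_mod_cast h5.ne'
    rw [hf0, hf1, hf2, hb4, hb2]; push_cast; field_simp; ring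
  have e1 : f1 = (a5 / b4 : ℝ) * z * f2 + f3 := by
    have hb' : (b4 : ℂ) ≠ 0 := by exact_mod_cast hb.ne'
    rw [hf1, hf2, hf3, hc3, hc1]; push_cast; field_simp; ring
  have e2 : f2 = (b4 / c3 : ℝ) * z * f3 + f4 := by
    have hc' : (c3 : ℂ) ≠ 0 := by exact_mod_cast hc.ne'
    rw [hf2, hf3, hf4, hd2]; push_cast; field_simp; ring
  have hz' := hz.le
  have hne : z ≠ 0 := by rintro rfl; simp at hz
  have p3 : 0 ≤ (f4 * conj f3).re := by
    rcases hd.eq_or_lt with hd | hd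
    -- A vanishing `d2` turns `he` into `c3 * a0 ≤ 0`, so the whole row `f4` is zero.
    · have : a0 = 0 := by
        rw [← hd] at he
        have : 0 ≤ c3 * a0 := by positivity
        have : c3 * a0 = 0 := by linarith
        exact (mul_eq_zero.1 this).resolve_left hc.ne'
      simp [hf4, ← hd, this]
    · have e3 : f3 = (c3 / d2 : ℝ) * z * f4 + ((c1 * d2 - c3 * a0) / d2 : ℝ) * z := by
        have hd' : (d2 : ℂ) ≠ 0 := by exact_mod_cast hd.ne'
        rw [hf3, hf4]; push_cast; field_simp; ring
      rw [e3]
      refine routh_step (by positivity) hz' ?_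
      have : ((((c1 * d2 - c3 * a0) / d2 : ℝ) : ℂ) * z * conj f4).re
          = (c1 * d2 - c3 * a0) / d2 * (d2 * z.re * Complex.normSq z + a0 * z.re) := by
        simp only [hf4, mul_assoc, Complex.re_ofReal_mul]
        congr 1
        simp [Complex.normSq_apply, pow_two]; ring
      rw [this]
      have := Complex.normSq_nonneg z
      positivity
  have p2 : 0 ≤ (f3 * conj f2).re := by rw [e2]; exact routh_step (by positivity) hz' p3
  have p1 : 0 ≤ (f2 * conj f1).re := by rw [e1]; exact routh_step (by positivity) hz' p2
  have p0 : 0 ≤ (f1 * conj f0).re := by rw [e0]; exact routh_step (by positivity) hz' p1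
  -- At a root, `Re (f1 * conj f0) = -|f1|²`, while the chain makes it nonnegative. Hence `f1 = 0`,
  -- and the divisions propagate this to every later remainder.
  have hs : f0 = -f1 := by rw [hf0, hf1]; linear_combination hroot
  have z1 : f1 = 0 := by
    rw [hs] at p0
    have : (f1 * conj (-f1)).re = -Complex.normSq f1 := by simp [Complex.normSq_apply]
    rw [this] at p0
    exact Complex.normSq_eq_zero.1 (le_antisymm (by linarith) (Complex.normSq_nonneg _))
  have z2 : f2 = 0 := by rw [hs, z1] at e0; simpa using e0.symm
  have z3 : f3 = 0 := by rw [z1, z2] at e1; simpa using e1.symm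
  have z4 : f4 = 0 := by rw [z2, z3] at e2; simpa using e2.symm
  rcases hd.eq_or_lt with hd | hd
  · have : z * ((c3 : ℂ) * z ^ 2 + c1) = 0 := by rw [← z3, hf3]; ring
    exact sq_mul_add_ne_zero hc (hd0 hd.symm) hz ((mul_eq_zero.1 this).resolve_left hne)
  · exact sq_mul_add_ne_zero hd h0 hz z4

/-- Routh–Hurwitz criterion in degree six in terms of the leading Hurwitz minors `h2, …, h5`,
of which the last two may vanish. -/
theorem hurwitz_six {a0 a1 a2 a3 a4 a5 a6 h2 h3 h4 h5 : ℝ}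
    (ha6 : 0 < a6) (ha5 : 0 < a5) (ha0 : 0 ≤ a0) (p2 : 0 < h2) (p3 : 0 < h3) (p4 : 0 ≤ h4)
    (p5 : 0 ≤ h5)
    (e2 : h2 = a5 * a4 - a6 * a3) (e3 : h3 = a3 * h2 - a5 * (a5 * a2 - a6 * a1))
    (e4 : a5 * h4 = h3 * (a5 * a2 - a6 * a1) - h2 ^ 2 * a1 + a5 ^ 2 * a0 * h2)
    (e5 : h2 * h5 = (a1 * h2 - a5 ^ 2 * a0) * h4 - h3 ^ 2 * a0)
    (hdeg : h4 = 0 → a0 = 0 → 0 ≤ a1)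
    {z : ℂ} (hz : 0 < z.re)
    (hroot : (a0 : ℂ) + a1 * z + a2 * z ^ 2 + a3 * z ^ 3 + a4 * z ^ 4 + a5 * z ^ 5 + a6 * z ^ 6
      = 0) : False := by
  -- The leading entries of the Routh rows are quotients of consecutive minors: `b4 = h2 / a5`, `c3
  -- = h3 / h2`, `d2 = h4 / h3`.
  have hd2 : h4 / h3 = (a5 * a2 - a6 * a1) / a5
      - h2 / a5 / (h3 / h2) * (a1 - a5 / (h2 / a5) * a0) := by
    field_simp
    linear_combination e4
  have he : (a1 - a5 / (h2 / a5) * a0) * (h4 / h3) - h3 / h2 * a0 = h5 / h3 := by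
    field_simp
    linear_combination -e5
  refine routh_six (b4 := h2 / a5) (b2 := (a5 * a2 - a6 * a1) / a5) (c3 := h3 / h2)
    (c1 := a1 - a5 / (h2 / a5) * a0) (d2 := h4 / h3) ha6 ha5 (by positivity) (by positivity)
    (by positivity) ha0 (by rw [e2]; field_simp) (by field_simp) ?_ rfl hd2
    (by rw [he]; positivity) ?_ hz hroot
  · rw [e3]; field_simp
  · intro h
    have h4' : h4 = 0 := by
      rcases div_eq_zero_iff.1 h with h | h
      · exact h
      · exact absurd h p3.ne'
    -- With `h4 = 0` the relation `e5` equates a nonnegative and a nonpositive quantity.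
    have h0' : a0 = 0 := by
      rw [h4'] at e5
      have h7 : h3 ^ 2 * a0 = -(h2 * h5) := by linarith
      have h8 : 0 ≤ h2 * h5 := by positivity
      have h9 : 0 ≤ h3 ^ 2 * a0 := by positivity
      have : h3 ^ 2 * a0 = 0 := by linarith
      exact (mul_eq_zero.1 this).resolve_left (by positivity)
    simpa [h0'] using hdeg h4' h0'

/-- A polynomial of degree six all of whose roots lie in the closed left half-plane is bounded
below on the open right half-plane by the sixth power of the real part. -/
theorem norm_le_of_roots_re_nonpos {a0 a1 a2 a3 a4 a5 a6 : ℝ} (h6 : 0 < a6)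
    (hr : ∀ z : ℂ, (a0 : ℂ) + a1 * z + a2 * z ^ 2 + a3 * z ^ 3 + a4 * z ^ 4 + a5 * z ^ 5
      + a6 * z ^ 6 = 0 → z.re ≤ 0) {w : ℂ} (hw : 0 < w.re) :
    a6 * w.re ^ 6 ≤ ‖(a0 : ℂ) + a1 * w + a2 * w ^ 2 + a3 * w ^ 3 + a4 * w ^ 4 + a5 * w ^ 5
      + a6 * w ^ 6‖ := by
  open Polynomial in
  let F : ℂ[X] := C (a0 : ℂ) + C (a1 : ℂ) * X + C (a2 : ℂ) * X ^ 2 + C (a3 : ℂ) * X ^ 3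
    + C (a4 : ℂ) * X ^ 4 + C (a5 : ℂ) * X ^ 5 + C (a6 : ℂ) * X ^ 6
  have h6' : (a6 : ℂ) ≠ 0 := by exact_mod_cast h6.ne'
  have hdeg : F.natDegree = 6 := by simp only [F]; compute_degree!; exact h6.ne'
  have hlead : F.leadingCoeff = a6 := by
    rw [Polynomial.leadingCoeff, hdeg]
    simp [F]
  have heval : ∀ z, F.eval z = (a0 : ℂ) + a1 * z + a2 * z ^ 2 + a3 * z ^ 3 + a4 * z ^ 4
      + a5 * z ^ 5 + a6 * z ^ 6 := fun z => by simp [F]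
  have hF0 : F ≠ 0 := by intro h; rw [h] at hdeg; simp at hdeg
  have hs : F.Splits := IsAlgClosed.splits F
  have hcard : F.roots.card = 6 := by rw [← hdeg]; exact hs.natDegree_eq_card_roots.symm
  rw [← heval w, hs.eval_eq_prod_roots, hlead, norm_mul]
  have hmem : ∀ z ∈ F.roots, z.re ≤ 0 := fun z hz =>
    hr z (by rw [← heval]; exact (Polynomial.mem_roots hF0).1 hz)
  -- Each linear factor satisfies `|w - z| ≥ Re (w - z) ≥ Re w`.
  have key : ∀ s : Multiset ℂ, (∀ z ∈ s, z.re ≤ 0) →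
      w.re ^ s.card ≤ ‖(s.map fun z => w - z).prod‖ := by
    intro s
    induction s using Multiset.induction with
    | empty => intro _; simp
    | cons z s ih =>
      intro h
      have h1 := ih fun y hy => h y (Multiset.mem_cons_of_mem hy)
      have h2 : w.re ≤ ‖w - z‖ := by
        have := Complex.re_le_norm (w - z)
        have := h z (Multiset.mem_cons_self z s)
        simp at *
        linarith
      simp only [Multiset.card_cons, Multiset.map_cons, Multiset.prod_cons, norm_mul, pow_succ']
      gcongr
  have := key F.roots hmem
  rw [hcard] at this
  rw [Complex.norm_real, Real.norm_of_nonneg h6.le]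
  gcongr

/-- If the odd and even parts of a quintic, with coefficients polynomial in `K`, have a common
root for every `K` (`hid`), then its constant term `a1` is nonnegative for `K ≥ 0`. Here
`h0 + h1 K` is the second Hurwitz minor. -/
theorem const_nonneg_of_common_root {c5 r c q3 q1 h0 h1 w1 w2 : ℝ} (h5 : 0 < c5) (hr : 0 < r)
    (hc : 0 ≤ c) (hh0 : 0 < h0) (hh1 : 0 ≤ h1)
    (hid : ∀ K : ℝ, ((r + q3 * K) * (h0 + h1 * K) - c5 * (w1 * K + w2 * K ^ 2))
      * (w1 * K + w2 * K ^ 2) = (h0 + h1 * K) ^ 2 * (r * c * K + q1 * K ^ 2))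
    {K : ℝ} (hK : 0 ≤ K)
    (h3 : 0 ≤ (r + q3 * K) * (h0 + h1 * K) - c5 * (w1 * K + w2 * K ^ 2)) :
    0 ≤ r * c * K + q1 * K ^ 2 := by
  -- Both sides are quartics in `K` without constant term, so four values determine all
  -- coefficients. The linear coefficient gives `w1`.
  have i1 := hid 1
  have i2 := hid 2
  have i3 := hid 3
  have i4 := hid 4
  have k1 : r * h0 * w1 = r * h0 * (h0 * c) := by linarith
  have hw1 : w1 = h0 * c := mul_left_cancel₀ (by positivity) k1
  -- This says that `h0 + h1 K` divides `w1 K + w2 K²`. For `h1 = 0` compare coefficients of `K⁴`;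
  -- otherwise evaluate at the zero of `h0 + h1 K`, where only `-c5` times a square survives.
  have hw2 : w2 * h0 = w1 * h1 := by
    rcases hh1.eq_or_lt with h | h
    · subst h
      have k4 : c5 * w2 ^ 2 = 0 := by linarith
      have : w2 = 0 := by simpa [h5.ne'] using k4
      simp [this]
    · have i := hid (-h0 / h1)
      have e : h0 + h1 * (-h0 / h1) = 0 := by field_simp; ring
      rw [e] at i
      have : w1 * (-h0 / h1) + w2 * (-h0 / h1) ^ 2 = 0 := by
        have : c5 * (w1 * (-h0 / h1) + w2 * (-h0 / h1) ^ 2) ^ 2 = 0 := by linarith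
        simpa [h5.ne'] using this
      field_simp at this
      have : h0 * (w2 * h0 - w1 * h1) = 0 := by linarith
      have := (mul_eq_zero.1 this).resolve_left hh0.ne'
      linarith
  have hW : w1 * K + w2 * K ^ 2 = c * K * (h0 + h1 * K) := by
    have : h0 * (w1 * K + w2 * K ^ 2) = h0 * (c * K * (h0 + h1 * K)) := by
      linear_combination K ^ 2 * hw2 + (h0 * K + K ^ 2 * h1) * hw1
    exact mul_left_cancel₀ hh0.ne' this
  have hp : 0 < h0 + h1 * K := by positivity
  have hW0 : 0 ≤ w1 * K + w2 * K ^ 2 := by rw [hW]; positivity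
  have := hid K
  have hnn := mul_nonneg h3 hW0
  rw [this] at hnn
  exact nonneg_of_mul_nonneg_right hnn (by positivity)

open Filter Topology Polynomial in
/-- Weak Hurwitz criterion for a family of sextics whose coefficients are polynomials in `K ≥ 0`:
nonnegative minors suffice when the family is nondegenerate at `K = 0`. -/
theorem re_nonpos_of_hurwitz_family {a0 a1 a2 a3 a4 h2 h3 h4 : ℝ → ℝ}
    {a5 a6 p0 q0 r c q1 p2 q2 q3 p4 q4 : ℝ}
    (ha6 : 0 < a6) (ha5 : 0 < a5) (hr : 0 < r) (hc : 0 ≤ c) (h20 : 0 < a5 * p4 - a6 * r)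
    (ea0 : ∀ K, a0 K = p0 * K ^ 2 + q0 * K ^ 3) (ea1 : ∀ K, a1 K = r * c * K + q1 * K ^ 2)
    (ea2 : ∀ K, a2 K = p2 * K + q2 * K ^ 2) (ea3 : ∀ K, a3 K = r + q3 * K)
    (ea4 : ∀ K, a4 K = p4 + q4 * K)
    (e2 : ∀ K, h2 K = a5 * a4 K - a6 * a3 K)
    (e3 : ∀ K, h3 K = a3 K * h2 K - a5 * (a5 * a2 K - a6 * a1 K))
    (e4 : ∀ K, a5 * h4 K = h3 K * (a5 * a2 K - a6 * a1 K) - h2 K ^ 2 * a1 K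
      + a5 ^ 2 * a0 K * h2 K)
    (n0 : ∀ K, 0 ≤ K → 0 ≤ a0 K) (n2 : ∀ K, 0 ≤ K → 0 ≤ h2 K) (n3 : ∀ K, 0 ≤ K → 0 ≤ h3 K)
    (n4 : ∀ K, 0 ≤ K → 0 ≤ h4 K)
    (n5 : ∀ K, 0 ≤ K → 0 ≤ (a1 K * h2 K - a5 ^ 2 * a0 K) * h4 K - h3 K ^ 2 * a0 K)
    {K : ℝ} (hK : 0 ≤ K) {z : ℂ}
    (hroot : (a0 K : ℂ) + a1 K * z + a2 K * z ^ 2 + a3 K * z ^ 3 + a4 K * z ^ 4 + a5 * z ^ 5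
      + a6 * z ^ 6 = 0) : z.re ≤ 0 := by
  let A0 : ℝ[X] := C p0 * X ^ 2 + C q0 * X ^ 3
  let A1 : ℝ[X] := C (r * c) * X + C q1 * X ^ 2
  let A2 : ℝ[X] := C p2 * X + C q2 * X ^ 2
  let A3 : ℝ[X] := C r + C q3 * X
  let A4 : ℝ[X] := C p4 + C q4 * X
  let H2 : ℝ[X] := C a5 * A4 - C a6 * A3
  let W : ℝ[X] := C a5 * A2 - C a6 * A1
  let H3 : ℝ[X] := A3 * H2 - C a5 * W
  let H4 : ℝ[X] := H3 * W - H2 ^ 2 * A1 + C (a5 ^ 2) * A0 * H2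
  have v0 : ∀ K, A0.eval K = a0 K := fun K => by simp [A0, ea0]
  have v1 : ∀ K, A1.eval K = a1 K := fun K => by simp [A1, ea1]
  have v2 : ∀ K, A2.eval K = a2 K := fun K => by simp [A2, ea2]
  have v3 : ∀ K, A3.eval K = a3 K := fun K => by simp [A3, ea3]
  have v4 : ∀ K, A4.eval K = a4 K := fun K => by simp [A4, ea4]
  have vH2 : ∀ K, H2.eval K = h2 K := fun K => by simp [H2, v3, v4, e2]
  have vW : ∀ K, W.eval K = a5 * a2 K - a6 * a1 K := fun K => by simp [W, v1, v2]
  have vH3 : ∀ K, H3.eval K = h3 K := fun K => by simp [H3, v3, vH2, vW, e3]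
  have vH4 : ∀ K, H4.eval K = a5 * h4 K := fun K => by simp [H4, vH3, vH2, vW, v1, v0, e4]
  -- At `K = 0` the minors are `a5 * p4 - a6 * r` and `r` times that, both positive.
  have hH2 : H2 ≠ 0 := by
    intro h
    have := vH2 0
    rw [h, e2, ea3, ea4] at this
    simp at this
    linarith
  have hH3 : H3 ≠ 0 := by
    intro h
    have := vH3 0
    rw [h, e3, e2, ea3, ea4, ea2, ea1] at this
    simp [hr.ne'] at this
    linarith
  have pos : ∀ᶠ y in 𝓝[>] K, 0 ≤ y ∧ 0 < h2 y ∧ 0 < h3 y := by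
    filter_upwards [self_mem_nhdsWithin, eventually_eval_ne_zero_right hH2 K,
      eventually_eval_ne_zero_right hH3 K] with y hy b2 b3
    have hy0 : 0 ≤ y := hK.trans (le_of_lt hy)
    rw [vH2] at b2
    rw [vH3] at b3
    exact ⟨hy0, (n2 y hy0).lt_of_ne' b2, (n3 y hy0).lt_of_ne' b3⟩
  have deg : ∀ᶠ y in 𝓝[>] K, h4 y = 0 → a0 y = 0 → 0 ≤ a1 y := by
    by_cases hH4 : H4 = 0
    · have z4 : ∀ y, h4 y = 0 := fun y => by
        have := vH4 y
        rw [hH4] at this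
        simpa [ha5.ne'] using this.symm
      -- With `h4 = 0`, `n5` reads `-h3² * a0 ≥ 0`, which excludes `a0 > 0` wherever `h3 > 0`.
      have hA0 : A0 = 0 := by
        by_contra hA0
        obtain ⟨y, ⟨hy, b2, b3⟩, hne⟩ :=
          (pos.and (eventually_eval_ne_zero_right hA0 K)).exists
        rw [v0] at hne
        have h1 := n5 y hy
        rw [z4] at h1
        have h2' := n0 y hy
        have h3' : 0 < h3 y ^ 2 * a0 y := by
          have := h2'.lt_of_ne' hne
          positivity
        linarith
      have hh1 : 0 ≤ a5 * q4 - a6 * q3 := by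
        by_contra! hneg
        -- With negative slope, the affine function `h2` would take the value `-h2 0 < 0` at twice
        -- its zero.
        have hpos : 0 ≤ 2 * ((a5 * p4 - a6 * r) / -(a5 * q4 - a6 * q3)) := by
          have : 0 < -(a5 * q4 - a6 * q3) := by linarith
          positivity
        have h1 := n2 _ hpos
        rw [e2, ea3, ea4] at h1
        have h2' : (a5 * q4 - a6 * q3) * ((a5 * p4 - a6 * r) / -(a5 * q4 - a6 * q3))
            = -(a5 * p4 - a6 * r) := by
          have := hneg.ne
          field_simp
        linarith
      refine pos.mono fun y hy _ _ => ?_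
      rw [ea1]
      refine const_nonneg_of_common_root (c5 := a5) (h0 := a5 * p4 - a6 * r)
        (h1 := a5 * q4 - a6 * q3) (w1 := a5 * p2 - a6 * (r * c)) (w2 := a5 * q2 - a6 * q1)
        (q3 := q3) ha5 hr hc h20 hh1 (fun x => ?_) hy.1 ?_
      · have h1 := e4 x
        rw [z4, ← v0, hA0, e3, e2, ea1, ea2, ea3, ea4] at h1
        simp only [eval_zero] at h1
        linear_combination -h1
      · have h1 := hy.2.2.le
        rw [e3, e2, ea1, ea2, ea3, ea4] at h1
        linarith
    · refine (eventually_eval_ne_zero_right hH4 K).mono fun y hy h => ?_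
      rw [vH4, h] at hy
      simp at hy
  -- Approaching from the right keeps the parameter nonnegative and the second and third minors
  -- strictly positive. There `|G|` is at least a fixed positive number, which contradicts `G K = 0`
  -- in the limit.
  by_contra! hz
  let G : ℝ → ℂ := fun y => (a0 y : ℂ) + a1 y * z + a2 y * z ^ 2 + a3 y * z ^ 3 + a4 y * z ^ 4
    + a5 * z ^ 5 + a6 * z ^ 6
  have hG : Continuous G := by
    simp only [G, ea0, ea1, ea2, ea3, ea4]
    fun_prop
  have lower : ∀ᶠ y in 𝓝[>] K, a6 * z.re ^ 6 ≤ ‖G y‖ := by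
    filter_upwards [pos, deg] with y hy hd
    refine norm_le_of_roots_re_nonpos ha6 (fun w hw => ?_) hz
    by_contra! hwre
    exact hurwitz_six ha6 ha5 (n0 y hy.1) hy.2.1 hy.2.2 (n4 y hy.1)
      (div_nonneg (n5 y hy.1) hy.2.1.le) (e2 y) (e3 y) (e4 y)
      (mul_div_cancel₀ _ hy.2.1.ne') hd hwre hw
  have lim : Tendsto (fun y => ‖G y‖) (𝓝[>] K) (𝓝 ‖G K‖) :=
    hG.norm.continuousAt.tendsto.mono_left nhdsWithin_le_nhds
  have := ge_of_tendsto lim lower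
  have hGK : G K = 0 := hroot
  rw [hGK, norm_zero] at this
  have : 0 < a6 * z.re ^ 6 := by positivity
  linarith

/-! ### Determinants: Hurwitz minors, dispersion relation, and the roots of its factors -/

theorem Matrix.det_fin_four {R : Type*} [CommRing R] (A : Matrix (Fin 4) (Fin 4) R) :
    A.det = A 0 0 * (A 1 1 * (A 2 2 * A 3 3 - A 2 3 * A 3 2) - A 1 2 * (A 2 1 * A 3 3 - A 2 3 * A 3 1) + A 1 3 * (A 2 1 * A 3 2 - A 2 2 * A 3 1))
     - A 0 1 * (A 1 0 * (A 2 2 * A 3 3 - A 2 3 * A 3 2) - A 1 2 * (A 2 0 * A 3 3 - A 2 3 * A 3 0) + A 1 3 * (A 2 0 * A 3 2 - A 2 2 * A 3 0))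
     + A 0 2 * (A 1 0 * (A 2 1 * A 3 3 - A 2 3 * A 3 1) - A 1 1 * (A 2 0 * A 3 3 - A 2 3 * A 3 0) + A 1 3 * (A 2 0 * A 3 1 - A 2 1 * A 3 0))
     - A 0 3 * (A 1 0 * (A 2 1 * A 3 2 - A 2 2 * A 3 1) - A 1 1 * (A 2 0 * A 3 2 - A 2 2 * A 3 0) + A 1 2 * (A 2 0 * A 3 1 - A 2 1 * A 3 0)) := by
  rw [Matrix.det_succ_row_zero]
  simp only [Fin.sum_univ_succ, Matrix.det_fin_three, Matrix.submatrix_apply]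
  simp [Fin.succAbove, Fin.lt_def]
  ring

/-- The determinant of a `5 × 5` matrix which is rotation covariant in its last three indices. -/
theorem det_scalar_vector_block {R : Type*} [CommRing R] (A B D E c d e f g s x y z : R) :
    (!![A, B, c * x, c * y, c * z;
        D, E, d * x, d * y, d * z;
        e * x, f * x, g * x * x + s, g * x * y, g * x * z;
        e * y, f * y, g * y * x, g * y * y + s, g * y * z;
        e * z, f * z, g * z * x, g * z * y, g * z * z + s] : Matrix (Fin 5) (Fin 5) R).det
      = s ^ 2 * ((A * E - B * D) * s + (x ^ 2 + y ^ 2 + z ^ 2)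
        * ((A * E - B * D) * g - A * d * f + B * d * e + c * D * f - c * E * e)) := by
  rw [Matrix.det_succ_row_zero]
  simp only [Fin.sum_univ_succ, Matrix.det_fin_four, Matrix.submatrix_apply]
  simp [Fin.succAbove, Fin.lt_def]
  ring

namespace FluidModel

theorem H_det_two (M : FluidModel) (p : ℝ × ℝ) (k : ℝ) (hm : 2 ≤ 6) :
    (M.H p k 2 hm).det = M.a p k 5 * M.a p k 4 - M.a p k 6 * M.a p k 3 := by
  rw [H, hurwitz, Matrix.det_fin_two]
  generalize M.a p k = a
  simp [Fin.castLE]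
  ring

theorem H_det_three (M : FluidModel) (p : ℝ × ℝ) (k : ℝ) (hm : 3 ≤ 6) (hm' : 2 ≤ 6) :
    (M.H p k 3 hm).det = M.a p k 3 * (M.H p k 2 hm').det
      - M.a p k 5 * (M.a p k 5 * M.a p k 2 - M.a p k 6 * M.a p k 1) := by
  rw [H_det_two, H, hurwitz, Matrix.det_fin_three]
  generalize M.a p k = a
  simp [Fin.castLE]
  ring

/-- The Routh recursion with denominators cleared; the right-hand side is divisible by `a5` as a
polynomial in the coefficients. Together with its neighbours it supplies the relations that
`hurwitz_six` expects. -/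
theorem H_det_four (M : FluidModel) (p : ℝ × ℝ) (k : ℝ) (hm : 4 ≤ 6) (hm' : 2 ≤ 6)
    (hm'' : 3 ≤ 6) :
    M.a p k 5 * (M.H p k 4 hm).det
      = (M.H p k 3 hm'').det * (M.a p k 5 * M.a p k 2 - M.a p k 6 * M.a p k 1)
        - (M.H p k 2 hm').det ^ 2 * M.a p k 1
        + M.a p k 5 ^ 2 * M.a p k 0 * (M.H p k 2 hm').det := by
  rw [H_det_three M p k hm'' hm', H_det_two, H, hurwitz]
  generalize M.a p k = a
  rw [Matrix.det_fin_four]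
  simp [Fin.castLE]
  ring

theorem H_det_five (M : FluidModel) (p : ℝ × ℝ) (k : ℝ) (hm : 5 ≤ 6) (hm2 : 2 ≤ 6)
    (hm3 : 3 ≤ 6) (hm4 : 4 ≤ 6) :
    (M.H p k 2 hm2).det * (M.H p k 5 hm).det
      = (M.a p k 1 * (M.H p k 2 hm2).det - M.a p k 5 ^ 2 * M.a p k 0) * (M.H p k 4 hm4).det
        - (M.H p k 3 hm3).det ^ 2 * M.a p k 0 := by
  rw [H_det_three M p k hm3 hm2, H_det_two, H, hurwitz, H, hurwitz]
  generalize M.a p k = a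
  rw [Matrix.det_succ_row_zero]
  simp only [Fin.sum_univ_succ, Matrix.det_fin_four, Matrix.submatrix_apply]
  simp [Fin.succAbove, Fin.lt_def, Fin.castLE]
  ring

/-- The `τQ` and `τJ` parts of `β` and `λ` are proportional to the derivatives of `P`, so they
cancel in the antisymmetric brackets; only the derivatives of `α` survive in the `k⁴` term. -/
theorem a_zero_eq (M : FluidModel) {p : ℝ × ℝ} (hn : 0 < p.2) (hρ : 0 < M.ρ p) (k : ℝ) :
    M.a p k 0 = (M.σ p + M.σ₀ p) * M.ρ p * M.s₂ p * k ^ 4 + M.D p * k ^ 6 := by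
  simp only [a, D, s₂, lamε, lamn, βε, βn, Matrix.cons_val_zero]
  field_simp
  ring

/-- The two directions transverse to `k` each contribute a shear factor; the longitudinal velocity
couples to `δε` and `δn`, which gives a further shear-type term and the sound sextic. -/
theorem det_dispersionMatrix (M : FluidModel) {p : ℝ × ℝ} (hρ : 0 < M.ρ p) (Γ : ℂ)
    {k : Fin 3 → ℝ} {q : ℝ} (hq : q ^ 2 = ∑ i, k i ^ 2) :
    (M.dispersionMatrix p Γ k).det = -(M.shearPoly p Γ q) ^ 2 * M.soundPoly p Γ q := by
  have hkk : ((k 0 : ℂ) ^ 2 + (k 1 : ℂ) ^ 2 + (k 2 : ℂ) ^ 2) = (q : ℂ) ^ 2 := by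
    rw [← Complex.ofReal_pow q, hq]
    simp [Fin.sum_univ_three]
  have hcs : (M.ρ p : ℂ) * M.csSq p = M.ρ p * dEps M.P p + p.2 * dNum M.P p := by
    have : M.ρ p * M.csSq p = M.ρ p * dEps M.P p + p.2 * dNum M.P p := by
      rw [csSq]; field_simp
    exact_mod_cast this
  have := det_scalar_vector_block (R := ℂ) (-M.lamε p * (q : ℂ) ^ 2)
    (M.τn p * Γ ^ 2 + Γ - M.lamn p * (q : ℂ) ^ 2) (M.τε p * Γ ^ 2 + Γ - M.βε p * (q : ℂ) ^ 2)
    (-M.βn p * (q : ℂ) ^ 2) (Complex.I * p.2 * (1 + (M.τn p + M.τJ p) * Γ))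
    (Complex.I * M.ρ p * (1 + (M.τε p + M.τQ p) * Γ))
    (Complex.I * (dEps M.P p + (M.τP p + M.βε p) * Γ)) (Complex.I * (dNum M.P p + M.βn p * Γ))
    (M.ζ p + 1 / 3 * M.η p - M.τP p * M.ρ p) (M.shearPoly p Γ q) (k 0) (k 1) (k 2)
  rw [hkk] at this
  refine (congrArg Matrix.det ?_).trans (this.trans ?_)
  · unfold dispersionMatrix
    rw [← hq]
    simp [shearPoly]
  · rw [show -(M.shearPoly p Γ q) ^ 2 * M.soundPoly p Γ q
      = M.shearPoly p Γ q ^ 2 * -M.soundPoly p Γ q by ring]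
    congr 1
    simp only [soundPoly, Fin.sum_univ_succ, a, V]
    simp [shearPoly]
    ring_nf
    simp only [Complex.I_sq]
    ring_nf
    -- `ρ c_s²` occurs in `a 1` and `a 3` only, with `Γ` and `τn τε Γ³`.
    linear_combination ((q : ℂ) ^ 2 * (Γ + M.τn p * M.τε p * Γ ^ 3)) * hcs

/-- The roots of the shear polynomial do not grow. -/
theorem re_nonpos_of_shearPoly_eq_zero (M : FluidModel) {p : ℝ × ℝ} (hρ : 0 < M.ρ p)
    (hη : 0 ≤ M.η p) (hτQ : 0 < M.τQ p) {Γ : ℂ} {k : ℝ} (h : M.shearPoly p Γ k = 0) :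
    Γ.re ≤ 0 := by
  by_contra! hΓ
  have hne : Γ ≠ 0 := by rintro rfl; simp at hΓ
  -- After multiplication by the conjugate of `Γ` every term has nonnegative real part, and `ρ |Γ|²`
  -- is strictly positive.
  have h1 : ((M.shearPoly p Γ k) * (starRingEnd ℂ) Γ).re
      = M.ρ p * M.τQ p * Γ.re * Complex.normSq Γ + M.ρ p * Complex.normSq Γ
        + M.η p * k ^ 2 * Γ.re := by
    have : M.shearPoly p Γ k = ((M.ρ p * M.τQ p : ℝ) : ℂ) * Γ ^ 2 + (M.ρ p : ℂ) * Γ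
        + ((M.η p * k ^ 2 : ℝ) : ℂ) := by simp [shearPoly]
    rw [this]
    simp only [add_mul, Complex.add_re, mul_assoc ((_ : ℝ) : ℂ), Complex.re_ofReal_mul]
    simp [Complex.normSq_apply, pow_two]
    ring
  rw [h] at h1
  have := Complex.normSq_pos.2 hne
  have : 0 < M.ρ p * M.τQ p * Γ.re * Complex.normSq Γ + M.ρ p * Complex.normSq Γ
      + M.η p * k ^ 2 * Γ.re := by positivity
  simp at h1
  linarith

/-- The coefficients of the sound polynomial are polynomials in `k ^ 2`. -/
theorem exists_a_eq (M : FluidModel) (p : ℝ × ℝ) : ∃ p0 q0 q1 p2 q2 q3 q4 : ℝ, ∀ k,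
    M.a p k 0 = p0 * (k ^ 2) ^ 2 + q0 * (k ^ 2) ^ 3 ∧
    M.a p k 1 = M.ρ p * M.csSq p * k ^ 2 + q1 * (k ^ 2) ^ 2 ∧
    M.a p k 2 = p2 * k ^ 2 + q2 * (k ^ 2) ^ 2 ∧
    M.a p k 3 = M.ρ p + q3 * k ^ 2 ∧
    M.a p k 4 = M.ρ p * (M.τQ p + M.τn p + M.τε p) + q4 * k ^ 2 ∧
    M.a p k 5 = M.ρ p * (M.τn p * M.τQ p + M.τn p * M.τε p + M.τQ p * M.τε p) ∧
    M.a p k 6 = M.ρ p * M.τn p * M.τQ p * M.τε p := by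
  -- This leaves exponents such as `2 * 2`, which agree with those in `a` by definition, so `rfl`
  -- can find the coefficients.
  simp only [← pow_mul]
  exact ⟨_, _, _, _, _, _, _, fun k => ⟨rfl, rfl, rfl, rfl, rfl, rfl, rfl⟩⟩

/-- The roots of the sound polynomial do not grow, under the weak Hurwitz conditions. -/
theorem re_nonpos_of_soundPoly_eq_zero (M : FluidModel) {p : ℝ × ℝ} (hρ : 0 < M.ρ p)
    (hcs : 0 ≤ M.csSq p) (hτn : 0 < M.τn p) (hτε : 0 < M.τε p) (hτQ : 0 < M.τQ p)
    (ha0 : ∀ k, 0 ≤ M.a p k 0)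
    (hH : ∀ k : ℝ, 0 ≤ k → ∀ (m : ℕ) (_ : 2 ≤ m) (hm : m ≤ 5),
      0 ≤ (M.H p k m (hm.trans (by norm_num))).det)
    {Γ : ℂ} {k : ℝ} (h : M.soundPoly p Γ k = 0) : Γ.re ≤ 0 := by
  obtain ⟨p0, q0, q1, p2, q2, q3, q4, ha⟩ := M.exists_a_eq p
  set c5 := M.ρ p * (M.τn p * M.τQ p + M.τn p * M.τε p + M.τQ p * M.τε p) with hc5
  set c6 := M.ρ p * M.τn p * M.τQ p * M.τε p with hc6
  set p4 := M.ρ p * (M.τQ p + M.τn p + M.τε p) with hp4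
  have c5pos : 0 < c5 := by positivity
  let a0 : ℝ → ℝ := fun K => p0 * K ^ 2 + q0 * K ^ 3
  let a1 : ℝ → ℝ := fun K => M.ρ p * M.csSq p * K + q1 * K ^ 2
  let a2 : ℝ → ℝ := fun K => p2 * K + q2 * K ^ 2
  let a3 : ℝ → ℝ := fun K => M.ρ p + q3 * K
  let a4 : ℝ → ℝ := fun K => p4 + q4 * K
  let h2 : ℝ → ℝ := fun K => c5 * a4 K - c6 * a3 K
  let h3 : ℝ → ℝ := fun K => a3 K * h2 K - c5 * (c5 * a2 K - c6 * a1 K)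
  let h4 : ℝ → ℝ := fun K => (h3 K * (c5 * a2 K - c6 * a1 K) - h2 K ^ 2 * a1 K
      + c5 ^ 2 * a0 K * h2 K) / c5
  have v2 : ∀ k, (M.H p k 2 (by norm_num)).det = h2 (k ^ 2) := fun k => by
    obtain ⟨e0, e1, e2, e3, e4, e5, e6⟩ := ha k
    rw [H_det_two, e3, e4, e5, e6]
  have v3 : ∀ k, (M.H p k 3 (by norm_num)).det = h3 (k ^ 2) := fun k => by
    obtain ⟨e0, e1, e2, e3, e4, e5, e6⟩ := ha k
    rw [H_det_three M p k _ (by norm_num), v2, e1, e2, e3, e5, e6]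
  have v4 : ∀ k, (M.H p k 4 (by norm_num)).det = h4 (k ^ 2) := fun k => by
    obtain ⟨e0, e1, e2, e3, e4, e5, e6⟩ := ha k
    rw [eq_div_iff c5pos.ne', mul_comm, ← e5, H_det_four M p k _ (by norm_num) (by norm_num), v2,
      v3, e0, e1, e2, e5, e6]
  have hK : ∀ K : ℝ, 0 ≤ K → ∃ k : ℝ, 0 ≤ k ∧ k ^ 2 = K :=
    fun K hK => ⟨Real.sqrt K, Real.sqrt_nonneg K, Real.sq_sqrt hK⟩
  refine re_nonpos_of_hurwitz_family (a0 := a0) (a1 := a1) (a2 := a2) (a3 := a3) (a4 := a4)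
    (h2 := h2) (h3 := h3) (h4 := h4) (a5 := c5) (a6 := c6) (p0 := p0) (q0 := q0) (r := M.ρ p)
    (c := M.csSq p) (q1 := q1) (p2 := p2) (q2 := q2) (q3 := q3) (p4 := p4) (q4 := q4)
    (by positivity) c5pos hρ hcs ?_ (fun _ => rfl) (fun _ => rfl) (fun _ => rfl) (fun _ => rfl)
    (fun _ => rfl) (fun _ => rfl) (fun _ => rfl) (fun _ => mul_div_cancel₀ _ c5pos.ne')
    ?_ ?_ ?_ ?_ ?_ (sq_nonneg k) (z := Γ) ?_
  -- In the second minor at `k = 0` the subtracted term cancels one of the products, leaving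
  -- positive terms only.
  · have : c5 * p4 - c6 * M.ρ p = M.ρ p ^ 2 * ((M.τn p * M.τQ p + M.τn p * M.τε p)
        * (M.τQ p + M.τn p + M.τε p) + M.τQ p * M.τε p * (M.τQ p + M.τε p)) := by
      rw [hc5, hp4, hc6]; ring
    rw [this]
    positivity
  · intro K h0
    obtain ⟨k, hk, rfl⟩ := hK K h0
    have := ha0 k
    rwa [(ha k).1] at this
  · intro K h0
    obtain ⟨k, hk, rfl⟩ := hK K h0
    rw [← v2]
    exact hH k hk 2 (by norm_num) (by norm_num)
  · intro K h0
    obtain ⟨k, hk, rfl⟩ := hK K h0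
    rw [← v3]
    exact hH k hk 3 (by norm_num) (by norm_num)
  · intro K h0
    obtain ⟨k, hk, rfl⟩ := hK K h0
    rw [← v4]
    exact hH k hk 4 (by norm_num) (by norm_num)
  · intro K h0
    obtain ⟨k, hk, rfl⟩ := hK K h0
    obtain ⟨e0, e1, e2, e3, e4, e5, e6⟩ := ha k
    have := H_det_five M p k (by norm_num) (by norm_num) (by norm_num) (by norm_num)
    rw [v2, v3, v4, e0, e1, e5] at this
    rw [← this, ← v2]
    exact mul_nonneg (hH k hk 2 (by norm_num) (by norm_num)) (hH k hk 5 (by norm_num) (by norm_num))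
  · obtain ⟨e0, e1, e2, e3, e4, e5, e6⟩ := ha k
    rw [← h, soundPoly, Fin.sum_univ_seven, e0, e1, e2, e3, e4, e5, e6]
    simp only [Fin.val_zero, Fin.val_one, pow_zero, pow_one, mul_one]
    rfl

end FluidModel

/-! ### Differentiating the constitutive relations at the rest state -/

open Filter Topology in
-- The difference quotient at `0` is `F` itself, so continuity suffices. Gradients of a perturbed
-- uniform state carry an explicit factor `s` and so have this shape.
theorem hasDerivAt_zero_self_mul {F : ℝ → ℝ} (hF : ContinuousAt F 0) :
    HasDerivAt (fun s => s * F s) (F 0) 0 := by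
  rw [hasDerivAt_iff_tendsto_slope]
  refine (hF.tendsto.mono_left nhdsWithin_le_nhds).congr' ?_
  filter_upwards [self_mem_nhdsWithin] with s hs
  have : s ≠ 0 := hs
  simp [slope_def_field]
  field_simp

open Filter Topology in
/-- The derivative of a product whose first factor is merely continuous, at a zero of the second. -/
theorem HasDerivAt.continuousAt_mul_of_eq_zero {c X : ℝ → ℝ} {X' x : ℝ} (hX : HasDerivAt X X' x)
    (hc : ContinuousAt c x) (h0 : X x = 0) : HasDerivAt (fun s => c s * X s) (c x * X') x := by
  rw [hasDerivAt_iff_tendsto_slope] at hX ⊢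
  refine ((hc.tendsto.mono_left nhdsWithin_le_nhds).mul hX).congr fun s => ?_
  simp [slope_def_field, h0]
  ring

theorem pd_const_add_mul (a : Fin 4) {g : Spacetime → ℝ} {x : Spacetime}
    (hg : DifferentiableAt ℝ g x) (c s : ℝ) : pd a (fun y => c + s * g y) x = s * pd a g x := by
  simp only [pd]
  rw [fderiv_const_add, fderiv_const_mul hg]
  simp

theorem fderiv_apply_pair (f : ℝ × ℝ → ℝ) (p v : ℝ × ℝ) :
    fderiv ℝ f p v = dEps f p * v.1 + dNum f p * v.2 := by
  have : v = v.1 • ((1, 0) : ℝ × ℝ) + v.2 • ((0, 1) : ℝ × ℝ) := by ext <;> simp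
  conv_lhs => rw [this, map_add, map_smul, map_smul]
  simp only [smul_eq_mul, dEps, dNum]
  ring

/-- The four-velocity of a fluid at rest. -/
def restU (a : Fin 4) : ℝ := (Pi.single 0 1 : Fin 4 → ℝ) a

/-- The projector onto the rest space of a fluid at rest. -/
def restProj (a b : Fin 4) : ℝ := minkowski a b + restU a * restU b

namespace FluidFields

variable {p : ℝ × ℝ} {δq : FluidFields} {x : Spacetime}

theorem hasDerivAt_u (a : Fin 4) :
    HasDerivAt (fun s => ((rest p).perturb δq s).u x a) (δq.u x a) 0 := by
  simpa [perturb] using ((hasDerivAt_id (0 : ℝ)).mul_const (δq.u x a)).const_add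
    ((rest p).u x a)

theorem u_perturb_zero (a : Fin 4) : ((rest p).perturb δq 0).u x a = restU a := by
  simp [perturb, rest, restU]

theorem hasDerivAt_proj (a b : Fin 4) :
    HasDerivAt (fun s => ((rest p).perturb δq s).proj x a b)
      (restU b * δq.u x a + restU a * δq.u x b) 0 := by
  have := ((hasDerivAt_u (p := p) (δq := δq) (x := x) a).mul (hasDerivAt_u (p := p) (δq := δq) (x := x) b)).const_add
    (minkowski a b)
  refine this.congr_deriv ?_
  rw [u_perturb_zero, u_perturb_zero]
  ring

theorem proj_perturb_zero (a b : Fin 4) :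
    ((rest p).perturb δq 0).proj x a b = restProj a b := by
  simp [proj, u_perturb_zero, restProj]

theorem hasDerivAt_divU (hu : ∀ a, DifferentiableAt ℝ (fun y => δq.u y a) x) :
    HasDerivAt (fun s => ((rest p).perturb δq s).divU x) (∑ a, pd a (fun y => δq.u y a) x) 0 := by
  have : (fun s => ((rest p).perturb δq s).divU x)
      = fun s => s * ∑ a, pd a (fun y => δq.u y a) x := by
    ext s
    rw [divU, Finset.mul_sum]
    exact Finset.sum_congr rfl fun a _ => pd_const_add_mul a (hu a) _ _
  rw [this]
  exact hasDerivAt_zero_self_mul continuousAt_const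

theorem divU_perturb_zero : ((rest p).perturb δq 0).divU x = 0 := by
  simp [divU, perturb, rest, pd]

theorem hasDerivAt_along {g : Spacetime → ℝ} (hg : DifferentiableAt ℝ g x) (c : ℝ) :
    HasDerivAt (fun s => ((rest p).perturb δq s).along (fun y => c + s * g y) x)
      (pd 0 g x) 0 := by
  have : (fun s => ((rest p).perturb δq s).along (fun y => c + s * g y) x)
      = fun s => s * ∑ a, ((rest p).perturb δq s).u x a * pd a g x := by
    ext s
    rw [along, Finset.mul_sum]
    refine Finset.sum_congr rfl fun a _ => ?_
    rw [pd_const_add_mul a hg]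
    ring
  rw [this]
  have hc : ∀ a, ContinuousAt (fun s => ((rest p).perturb δq s).u x a) 0 :=
    fun a => (hasDerivAt_u a).continuousAt
  refine (hasDerivAt_zero_self_mul (by fun_prop)).congr_deriv ?_
  simp [u_perturb_zero, restU, Pi.single_apply]

/-- The literal `c + 0 * g y` is what the fields of `perturb` at `s = 0` unfold to, so the statement
applies to them by definition. -/
theorem along_const_add_zero_mul (q : FluidFields) (g : Spacetime → ℝ) (c : ℝ) :
    q.along (fun y => c + 0 * g y) x = 0 := by
  simp [along, pd]

theorem hasDerivAt_pgrad {g : Spacetime → ℝ} (hg : DifferentiableAt ℝ g x) (c : ℝ) (a : Fin 4) :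
    HasDerivAt (fun s => ((rest p).perturb δq s).pgrad (fun y => c + s * g y) x a)
      (∑ b, restProj a b * pd b g x) 0 := by
  have : (fun s => ((rest p).perturb δq s).pgrad (fun y => c + s * g y) x a)
      = fun s => s * ∑ b, ((rest p).perturb δq s).proj x a b * pd b g x := by
    ext s
    rw [pgrad, Finset.mul_sum]
    refine Finset.sum_congr rfl fun b _ => ?_
    rw [pd_const_add_mul b hg]
    ring
  rw [this]
  have hc : ∀ b, ContinuousAt (fun s => ((rest p).perturb δq s).proj x a b) 0 :=
    fun b => (hasDerivAt_proj a b).continuousAt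
  refine (hasDerivAt_zero_self_mul (by fun_prop)).congr_deriv ?_
  simp [proj_perturb_zero]

theorem pgrad_const_add_zero_mul (q : FluidFields) (g : Spacetime → ℝ) (c : ℝ) (a : Fin 4) :
    q.pgrad (fun y => c + 0 * g y) x a = 0 := by
  simp [pgrad, pd]

/-- The coefficient of `∂_c u_d` in the shear tensor of a fluid at rest. -/
noncomputable def restShearCoeff (a b c d : Fin 4) : ℝ :=
  (restProj a c * restProj d b + restProj a d * restProj c b) / 2
    - 1 / 3 * restProj a b * restProj c d

theorem pd_uLow (hu : ∀ a, DifferentiableAt ℝ (fun y => δq.u y a) x) (s : ℝ) (c d : Fin 4) :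
    pd c (((rest p).perturb δq s).uLow d) x
      = s * ∑ k, minkowski d k * pd c (fun y => δq.u y k) x := by
  have : ((rest p).perturb δq s).uLow d
      = fun y => ∑ k, (minkowski d k * restU k + (s * minkowski d k) * δq.u y k) := by
    ext y
    refine Finset.sum_congr rfl fun k _ => ?_
    simp only [perturb, rest, restU]
    ring
  rw [this, pd, fderiv_fun_sum (by fun_prop), sum_apply, Finset.mul_sum]
  refine Finset.sum_congr rfl fun k _ => ?_
  rw [← mul_assoc]
  exact pd_const_add_mul c (hu k) _ _

theorem hasDerivAt_shear (hu : ∀ a, DifferentiableAt ℝ (fun y => δq.u y a) x) (a b : Fin 4) :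
    HasDerivAt (fun s => ((rest p).perturb δq s).shear x a b)
      (∑ c, ∑ d, restShearCoeff a b c d * ∑ k, minkowski d k * pd c (fun y => δq.u y k) x) 0 := by
  have : (fun s => ((rest p).perturb δq s).shear x a b)
      = fun s => s * ∑ c, ∑ d, ((((rest p).perturb δq s).proj x a c
        * ((rest p).perturb δq s).proj x d b + ((rest p).perturb δq s).proj x a d
        * ((rest p).perturb δq s).proj x c b) / 2 - 1 / 3 * ((rest p).perturb δq s).proj x a b
        * ((rest p).perturb δq s).proj x c d)
        * ∑ k, minkowski d k * pd c (fun y => δq.u y k) x := by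
    ext s
    simp only [shear, Finset.mul_sum, pd_uLow hu]
    refine Finset.sum_congr rfl fun c _ => Finset.sum_congr rfl fun d _ =>
      Finset.sum_congr rfl fun k _ => ?_
    ring
  rw [this]
  have hc : ∀ a b, ContinuousAt (fun s => ((rest p).perturb δq s).proj x a b) 0 :=
    fun a b => (hasDerivAt_proj a b).continuousAt
  refine (hasDerivAt_zero_self_mul (by fun_prop)).congr_deriv ?_
  simp only [proj_perturb_zero, restShearCoeff]

theorem shear_perturb_zero (hu : ∀ a, DifferentiableAt ℝ (fun y => δq.u y a) x) (a b : Fin 4) :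
    ((rest p).perturb δq 0).shear x a b = 0 := by
  simp [shear, pd_uLow hu]

theorem st_perturb_zero : ((rest p).perturb δq 0).st x = p := by
  simp [st, perturb, rest]

theorem hasDerivAt_st :
    HasDerivAt (fun s => ((rest p).perturb δq s).st x) (δq.ε x, δq.n x) 0 := by
  have h : ∀ c d : ℝ, HasDerivAt (fun s : ℝ => c + s * d) d 0 := fun c d => by
    simpa using ((hasDerivAt_id (0 : ℝ)).mul_const d).const_add c
  exact (h p.1 _).prodMk (h p.2 _)

theorem continuousAt_comp_st {c : ℝ × ℝ → ℝ} (hc : ContinuousAt c p) :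
    ContinuousAt (fun s => c (((rest p).perturb δq s).st x)) 0 :=
  ContinuousAt.comp (f := fun s => ((rest p).perturb δq s).st x)
    (by rwa [st_perturb_zero]) hasDerivAt_st.continuousAt

theorem hasDerivAt_comp_st {c : ℝ × ℝ → ℝ} (hc : DifferentiableAt ℝ c p) :
    HasDerivAt (fun s => c (((rest p).perturb δq s).st x))
      (dEps c p * δq.ε x + dNum c p * δq.n x) 0 := by
  have h : HasFDerivAt c (fderiv ℝ c p) (((rest p).perturb δq 0).st x) := by
    rw [st_perturb_zero]; exact hc.hasFDerivAt
  refine (h.comp_hasDerivAt (0 : ℝ) hasDerivAt_st).congr_deriv ?_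
  rw [fderiv_apply_pair]

end FluidFields

namespace FluidModel

variable {M : FluidModel} {p : ℝ × ℝ}

/-- The coefficients `β` and `λ` contain first derivatives of `P` and `α`; for a `C¹` equation of
state they are continuous, which is all the linearisation asks of them. -/
theorem continuousAt_dEps {f : ℝ × ℝ → ℝ} (hf : ContDiffAt ℝ 1 f p) :
    ContinuousAt (dEps f) p :=
  (hf.continuousAt_fderiv (by simp)).clm_apply continuousAt_const

theorem continuousAt_dNum {f : ℝ × ℝ → ℝ} (hf : ContDiffAt ℝ 1 f p) :
    ContinuousAt (dNum f) p :=
  (hf.continuousAt_fderiv (by simp)).clm_apply continuousAt_const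

namespace RegularAt

theorem contDiffAt_α (h : M.RegularAt p) (hT : M.T p ≠ 0) : ContDiffAt ℝ 1 M.α p :=
  h.μ.div h.T hT

theorem continuousAt_ρ (h : M.RegularAt p) : ContinuousAt M.ρ p :=
  continuousAt_fst.add h.P.continuousAt

theorem continuousAt_lamε (h : M.RegularAt p) (hT : M.T p ≠ 0) (hρ : M.ρ p ≠ 0) :
    ContinuousAt M.lamε p :=
  ((h.σ₀.neg.mul h.T.continuousAt).mul (continuousAt_dEps (h.contDiffAt_α hT))).add
    ((h.τJ.mul (continuousAt_snd.div h.continuousAt_ρ hρ)).mul (continuousAt_dEps h.P))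

theorem continuousAt_lamn (h : M.RegularAt p) (hT : M.T p ≠ 0) (hρ : M.ρ p ≠ 0) :
    ContinuousAt M.lamn p :=
  ((h.σ₀.neg.mul h.T.continuousAt).mul (continuousAt_dNum (h.contDiffAt_α hT))).add
    ((h.τJ.mul (continuousAt_snd.div h.continuousAt_ρ hρ)).mul (continuousAt_dNum h.P))

theorem continuousAt_βε (h : M.RegularAt p) (hT : M.T p ≠ 0) (hn : p.2 ≠ 0) :
    ContinuousAt M.βε p :=
  (((h.σ.mul h.T.continuousAt).mul (h.continuousAt_ρ.div continuousAt_snd hn)).mul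
    (continuousAt_dEps (h.contDiffAt_α hT))).add (h.τQ.mul (continuousAt_dEps h.P))

theorem continuousAt_βn (h : M.RegularAt p) (hT : M.T p ≠ 0) (hn : p.2 ≠ 0) :
    ContinuousAt M.βn p :=
  (((h.σ.mul h.T.continuousAt).mul (h.continuousAt_ρ.div continuousAt_snd hn)).mul
    (continuousAt_dNum (h.contDiffAt_α hT))).add (h.τQ.mul (continuousAt_dNum h.P))

end RegularAt

end FluidModel

/-! ### Linearised fluxes as real-linear functions of the jet -/

/-- First-order jet of a perturbation `(δε, δn, δu)`: values and partial derivatives,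
`du a b = ∂_a δu^b`. -/
structure FluidJet (E : Type*) where
  ε : E
  n : E
  u : Fin 4 → E
  dε : Fin 4 → E
  dn : Fin 4 → E
  du : Fin 4 → Fin 4 → E

namespace FluidJet

variable {E F : Type*} [AddCommGroup E] [Module ℝ E] [AddCommGroup F] [Module ℝ F]

/-- The image of a jet under a linear map. -/
def map (f : E →ₗ[ℝ] F) (j : FluidJet E) : FluidJet F where
  ε := f j.ε
  n := f j.n
  u a := f (j.u a)
  dε a := f (j.dε a)
  dn a := f (j.dn a)
  du a b := f (j.du a b)

/-- Linearised expansion. -/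
def div (j : FluidJet E) : E := ∑ a, j.du a a

/-- Linearised shear tensor. -/
noncomputable def shear (j : FluidJet E) (a b : Fin 4) : E :=
  ∑ c, ∑ d, FluidFields.restShearCoeff a b c d • ∑ k, minkowski d k • j.du c k

/-- Linearised heat flux. -/
noncomputable def heat (M : FluidModel) (p : ℝ × ℝ) (j : FluidJet E) (a : Fin 4) : E :=
  (M.τQ p * M.ρ p) • j.du 0 a + M.βε p • ∑ b, restProj a b • j.dε b
    + M.βn p • ∑ b, restProj a b • j.dn b

/-- Linearised stress-energy tensor around a fluid at rest. -/
noncomputable def stress (M : FluidModel) (p : ℝ × ℝ) (j : FluidJet E) (a b : Fin 4) : E :=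
  (restU a * restU b) • (j.ε + M.τε p • (j.dε 0 + M.ρ p • j.div))
    + M.ρ p • (restU b • j.u a + restU a • j.u b)
    + restProj a b • (dEps M.P p • j.ε + dNum M.P p • j.n - M.ζ p • j.div
      + M.τP p • (j.dε 0 + M.ρ p • j.div))
    + restU a • j.heat M p b + restU b • j.heat M p a - (2 * M.η p) • j.shear a b

/-- Linearised charge current around a fluid at rest. -/
noncomputable def current (M : FluidModel) (p : ℝ × ℝ) (j : FluidJet E) (a : Fin 4) : E :=
  restU a • (j.n + M.τn p • (p.2 • j.div + j.dn 0)) + p.2 • j.u a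
    + ((M.τJ p * p.2) • j.du 0 a + M.lamε p • ∑ b, restProj a b • j.dε b
      + M.lamn p • ∑ b, restProj a b • j.dn b)

/-- Real-linearity in the jet allows one formula to serve real perturbations and complex amplitudes
alike. -/
theorem stress_map (M : FluidModel) (p : ℝ × ℝ) (f : E →ₗ[ℝ] F) (j : FluidJet E) (a b : Fin 4) :
    (j.map f).stress M p a b = f (j.stress M p a b) := by
  simp only [stress, heat, shear, div, map, map_add, map_sub, map_smul, map_sum]

theorem current_map (M : FluidModel) (p : ℝ × ℝ) (f : E →ₗ[ℝ] F) (j : FluidJet E) (a : Fin 4) :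
    (j.map f).current M p a = f (j.current M p a) := by
  simp only [current, div, map, map_add, map_smul, map_sum]

end FluidJet

/-- The jet of a perturbation at a point. -/
noncomputable def FluidFields.jet (δq : FluidFields) (x : Spacetime) : FluidJet ℝ where
  ε := δq.ε x
  n := δq.n x
  u := δq.u x
  dε a := pd a δq.ε x
  dn a := pd a δq.n x
  du a b := pd a (fun y => δq.u y b) x

namespace FluidModel

open FluidFields

variable {M : FluidModel} {p : ℝ × ℝ} {δq : FluidFields} {x : Spacetime}

theorem hasDerivAt_calQ (h : M.RegularAt p) (hT : M.T p ≠ 0) (hn : p.2 ≠ 0)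
    (hε : DifferentiableAt ℝ δq.ε x) (hδn : DifferentiableAt ℝ δq.n x)
    (hu : ∀ a, DifferentiableAt ℝ (fun y => δq.u y a) x) (a : Fin 4) :
    HasDerivAt (fun s => M.calQ ((rest p).perturb δq s) x a) ((δq.jet x).heat M p a) 0 := by
  have h1 := (hasDerivAt_along (p := p) (δq := δq) (hu a) (restU a)).continuousAt_mul_of_eq_zero
    (continuousAt_comp_st (δq := δq) (x := x) (h.τQ.mul h.continuousAt_ρ))
    (along_const_add_zero_mul _ _ _)
  have h2 := (hasDerivAt_pgrad (p := p) (δq := δq) hε p.1 a).continuousAt_mul_of_eq_zero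
    (continuousAt_comp_st (δq := δq) (x := x) (h.continuousAt_βε hT hn))
    (pgrad_const_add_zero_mul _ _ _ _)
  have h3 := (hasDerivAt_pgrad (p := p) (δq := δq) hδn p.2 a).continuousAt_mul_of_eq_zero
    (continuousAt_comp_st (δq := δq) (x := x) (h.continuousAt_βn hT hn))
    (pgrad_const_add_zero_mul _ _ _ _)
  refine ((h1.add h2).add h3).congr_deriv ?_
  simp only [st_perturb_zero, FluidJet.heat, jet, smul_eq_mul, Pi.mul_apply]

theorem calQ_zero (a : Fin 4) : M.calQ ((rest p).perturb δq 0) x a = 0 := by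
  have h1 := along_const_add_zero_mul (x := x) ((rest p).perturb δq 0) (fun y => δq.u y a) (restU a)
  have h2 := pgrad_const_add_zero_mul (x := x) ((rest p).perturb δq 0) δq.ε p.1 a
  have h3 := pgrad_const_add_zero_mul (x := x) ((rest p).perturb δq 0) δq.n p.2 a
  have h1' : ((rest p).perturb δq 0).along (fun y => ((rest p).perturb δq 0).u y a) x = 0 := h1
  have h2' : ((rest p).perturb δq 0).pgrad ((rest p).perturb δq 0).ε x a = 0 := h2
  have h3' : ((rest p).perturb δq 0).pgrad ((rest p).perturb δq 0).n x a = 0 := h3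
  rw [calQ, h1', h2', h3']
  simp

theorem hasDerivAt_calJ (h : M.RegularAt p) (hT : M.T p ≠ 0) (hρ : M.ρ p ≠ 0)
    (hε : DifferentiableAt ℝ δq.ε x) (hδn : DifferentiableAt ℝ δq.n x)
    (hu : ∀ a, DifferentiableAt ℝ (fun y => δq.u y a) x) (a : Fin 4) :
    HasDerivAt (fun s => M.calJ ((rest p).perturb δq s) x a)
      ((M.τJ p * p.2) * pd 0 (fun y => δq.u y a) x + M.lamε p * ∑ b, restProj a b * pd b δq.ε x
      + M.lamn p * ∑ b, restProj a b * pd b δq.n x) 0 := by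
  have h1 := (hasDerivAt_along (p := p) (δq := δq) (hu a) (restU a)).continuousAt_mul_of_eq_zero
    (continuousAt_comp_st (δq := δq) (x := x) (h.τJ.mul continuousAt_snd))
    (along_const_add_zero_mul _ _ _)
  have h2 := (hasDerivAt_pgrad (p := p) (δq := δq) hε p.1 a).continuousAt_mul_of_eq_zero
    (continuousAt_comp_st (δq := δq) (x := x) (h.continuousAt_lamε hT hρ))
    (pgrad_const_add_zero_mul _ _ _ _)
  have h3 := (hasDerivAt_pgrad (p := p) (δq := δq) hδn p.2 a).continuousAt_mul_of_eq_zero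
    (continuousAt_comp_st (δq := δq) (x := x) (h.continuousAt_lamn hT hρ))
    (pgrad_const_add_zero_mul _ _ _ _)
  refine ((h1.add h2).add h3).congr_deriv ?_
  simp only [st_perturb_zero, Pi.mul_apply]

/-- The rate of change of energy density plus `ρ` times the expansion. -/
theorem hasDerivAt_energy_residual (h : M.RegularAt p) (hε : DifferentiableAt ℝ δq.ε x)
    (hu : ∀ a, DifferentiableAt ℝ (fun y => δq.u y a) x) :
    HasDerivAt (fun s => ((rest p).perturb δq s).along ((rest p).perturb δq s).ε x
        + M.ρ (((rest p).perturb δq s).st x) * ((rest p).perturb δq s).divU x)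
      (pd 0 δq.ε x + M.ρ p * ∑ a, pd a (fun y => δq.u y a) x) 0 := by
  have h1 := hasDerivAt_along (p := p) (δq := δq) hε p.1
  have h2 := (hasDerivAt_divU (p := p) hu).continuousAt_mul_of_eq_zero
    (continuousAt_comp_st (δq := δq) (x := x) h.continuousAt_ρ) divU_perturb_zero
  rw [st_perturb_zero] at h2
  exact h1.add h2

theorem along_ε_zero : ((rest p).perturb δq 0).along ((rest p).perturb δq 0).ε x = 0 :=
  along_const_add_zero_mul _ _ _

theorem along_n_zero : ((rest p).perturb δq 0).along ((rest p).perturb δq 0).n x = 0 :=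
  along_const_add_zero_mul _ _ _

theorem calA_zero : M.calA ((rest p).perturb δq 0) x = 0 := by
  rw [calA, along_ε_zero, divU_perturb_zero]; simp

theorem calPi_zero : M.calPi ((rest p).perturb δq 0) x = 0 := by
  rw [calPi, along_ε_zero, divU_perturb_zero]; simp

theorem calN_zero : M.calN ((rest p).perturb δq 0) x = 0 := by
  rw [calN, along_n_zero, divU_perturb_zero]; simp

theorem hasDerivAt_calA (h : M.RegularAt p) (hε : DifferentiableAt ℝ δq.ε x)
    (hu : ∀ a, DifferentiableAt ℝ (fun y => δq.u y a) x) :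
    HasDerivAt (fun s => M.calA ((rest p).perturb δq s) x)
      (M.τε p * (pd 0 δq.ε x + M.ρ p * ∑ a, pd a (fun y => δq.u y a) x)) 0 := by
  have := (hasDerivAt_energy_residual h hε hu).continuousAt_mul_of_eq_zero
    (continuousAt_comp_st (δq := δq) (x := x) h.τε)
    (by rw [along_ε_zero, divU_perturb_zero]; simp)
  rwa [st_perturb_zero] at this

theorem hasDerivAt_calPi (h : M.RegularAt p) (hε : DifferentiableAt ℝ δq.ε x)
    (hu : ∀ a, DifferentiableAt ℝ (fun y => δq.u y a) x) :
    HasDerivAt (fun s => M.calPi ((rest p).perturb δq s) x)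
      (-M.ζ p * (∑ a, pd a (fun y => δq.u y a) x)
        + M.τP p * (pd 0 δq.ε x + M.ρ p * ∑ a, pd a (fun y => δq.u y a) x)) 0 := by
  have h1 := (hasDerivAt_energy_residual h hε hu).continuousAt_mul_of_eq_zero
    (continuousAt_comp_st (δq := δq) (x := x) h.τP)
    (by rw [along_ε_zero, divU_perturb_zero]; simp)
  have h2 := (hasDerivAt_divU (p := p) hu).continuousAt_mul_of_eq_zero
    (continuousAt_comp_st (δq := δq) (x := x) h.ζ.neg) divU_perturb_zero
  rw [st_perturb_zero] at h1 h2
  exact h2.add h1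

theorem hasDerivAt_calN (h : M.RegularAt p) (hδn : DifferentiableAt ℝ δq.n x)
    (hu : ∀ a, DifferentiableAt ℝ (fun y => δq.u y a) x) :
    HasDerivAt (fun s => M.calN ((rest p).perturb δq s) x)
      (M.τn p * (p.2 * (∑ a, pd a (fun y => δq.u y a) x) + pd 0 δq.n x)) 0 := by
  have h1 := hasDerivAt_along (p := p) (δq := δq) hδn p.2
  have h2 := (hasDerivAt_divU (p := p) hu).continuousAt_mul_of_eq_zero
    (continuousAt_comp_st (p := p) (δq := δq) (x := x) continuousAt_snd) divU_perturb_zero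
  rw [st_perturb_zero] at h2
  have := (h2.add h1).continuousAt_mul_of_eq_zero
    (continuousAt_comp_st (δq := δq) (x := x) h.τn)
    (by simp [divU_perturb_zero, along, pd])
  rwa [st_perturb_zero] at this

/-- `N` and `𝒥` vanish at rest, so the product rule retains only their first variations and the
variation of `n u`. -/
theorem δcurrent_rest (h : M.RegularAt p) (hT : M.T p ≠ 0) (hρ : M.ρ p ≠ 0)
    (hε : DifferentiableAt ℝ δq.ε x) (hδn : DifferentiableAt ℝ δq.n x)
    (hu : ∀ a, DifferentiableAt ℝ (fun y => δq.u y a) x) (a : Fin 4) :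
    M.δcurrent (rest p) δq a x = (δq.jet x).current M p a := by
  have hn1 := hasDerivAt_comp_st (c := Prod.snd) (p := p) (δq := δq) (x := x)
    differentiableAt_snd
  have hd : dEps (Prod.snd : ℝ × ℝ → ℝ) p = 0 ∧ dNum (Prod.snd : ℝ × ℝ → ℝ) p = 1 := by
    simp [dEps, dNum, fderiv_snd]
  rw [hd.1, hd.2] at hn1
  have := (((hn1.add (hasDerivAt_calN h hδn hu)).mul
    (hasDerivAt_u (p := p) (δq := δq) (x := x) a)).add
      (hasDerivAt_calJ h hT hρ hε hδn hu a)).deriv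
  refine (Eq.trans ?_ this).trans ?_
  · rfl
  · simp only [Pi.add_apply, u_perturb_zero, calN_zero, st_perturb_zero, FluidJet.current,
      FluidJet.div, jet, smul_eq_mul]
    ring

theorem δstress_rest (h : M.RegularAt p) (hT : M.T p ≠ 0) (hn : p.2 ≠ 0)
    (hε : DifferentiableAt ℝ δq.ε x) (hδn : DifferentiableAt ℝ δq.n x)
    (hu : ∀ a, DifferentiableAt ℝ (fun y => δq.u y a) x) (a b : Fin 4) :
    M.δstress (rest p) δq a b x = (δq.jet x).stress M p a b := by
  have hε1 := hasDerivAt_comp_st (c := Prod.fst) (p := p) (δq := δq) (x := x)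
    differentiableAt_fst
  have hd : dEps (Prod.fst : ℝ × ℝ → ℝ) p = 1 ∧ dNum (Prod.fst : ℝ × ℝ → ℝ) p = 0 := by
    simp [dEps, dNum, fderiv_fst]
  rw [hd.1, hd.2] at hε1
  have hP := hasDerivAt_comp_st (p := p) (δq := δq) (x := x) (h.P.differentiableAt (by simp))
  have u := fun a => hasDerivAt_u (p := p) (δq := δq) (x := x) a
  have Q := fun a => hasDerivAt_calQ h hT hn hε hδn hu a
  have S := (hasDerivAt_shear (p := p) hu a b).continuousAt_mul_of_eq_zero
    (continuousAt_comp_st (δq := δq) (x := x) (h.η.const_mul 2)) (shear_perturb_zero hu a b)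
  have := (((((((hε1.add (hasDerivAt_calA h hε hu)).mul (u a)).mul (u b)).add
    ((hP.add (hasDerivAt_calPi h hε hu)).mul (hasDerivAt_proj (p := p) (δq := δq) (x := x) a b))).add
    ((u a).mul (Q b))).add ((u b).mul (Q a))).sub S).deriv
  refine (Eq.trans ?_ this).trans ?_
  · rfl
  · simp only [Pi.add_apply, Pi.mul_apply, u_perturb_zero, calA_zero, calPi_zero, calQ_zero,
      proj_perturb_zero, st_perturb_zero, FluidJet.stress, FluidJet.div, FluidJet.shear, jet,
      smul_eq_mul, ρ]
    ring

end FluidModel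

/-! ### Plane waves and the kernel of the dispersion matrix -/

/-- The symbol of `∂_a` on plane waves `exp (Γ t + i k·x)`. -/
noncomputable def waveSymbol (Γ : ℂ) (k : Fin 3 → ℝ) : Fin 4 → ℂ :=
  ![Γ, Complex.I * k 0, Complex.I * k 1, Complex.I * k 2]

section PlaneWave

variable {Γ : ℂ} {k : Fin 3 → ℝ}

theorem phase_eq (x : Spacetime) :
    phase Γ k x = Complex.exp (∑ b, (x b : ℂ) * waveSymbol Γ k b) := by
  simp only [phase, waveSymbol, Fin.sum_univ_four, Fin.sum_univ_three]
  congr 1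
  simp
  ring

theorem phase_zero : phase Γ k 0 = 1 := by simp [phase]

theorem hasFDerivAt_phase (x : Spacetime) :
    HasFDerivAt (phase Γ k) (phase Γ k x • ∑ b, (Complex.ofRealCLM.comp
      (ContinuousLinearMap.proj (R := ℝ) (φ := fun _ : Fin 4 => ℝ) b)).smulRight
        (waveSymbol Γ k b)) x := by
  have h : phase Γ k = fun x => Complex.exp ((∑ b, (Complex.ofRealCLM.comp
      (ContinuousLinearMap.proj (R := ℝ) (φ := fun _ : Fin 4 => ℝ) b)).smulRight
        (waveSymbol Γ k b)) x) := by
    ext x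
    rw [phase_eq]
    simp
  have := (ContinuousLinearMap.hasFDerivAt (∑ b, (Complex.ofRealCLM.comp
      (ContinuousLinearMap.proj (R := ℝ) (φ := fun _ : Fin 4 => ℝ) b)).smulRight
        (waveSymbol Γ k b)) (x := x)).cexp
  rw [h]
  exact this

theorem hasFDerivAt_wave (r : ℂ →L[ℝ] ℝ) (z : ℂ) (x : Spacetime) :
    HasFDerivAt (fun y => r (phase Γ k y * z)) (r.comp (z • (phase Γ k x • ∑ b,
      (Complex.ofRealCLM.comp
        (ContinuousLinearMap.proj (R := ℝ) (φ := fun _ : Fin 4 => ℝ) b)).smulRight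
          (waveSymbol Γ k b)))) x :=
  r.hasFDerivAt.comp x ((hasFDerivAt_phase x).mul_const z)

theorem pd_wave (r : ℂ →L[ℝ] ℝ) (z : ℂ) (a : Fin 4) (x : Spacetime) :
    pd a (fun y => r (phase Γ k y * z)) x = r (phase Γ k x * (waveSymbol Γ k a * z)) := by
  rw [pd, (hasFDerivAt_wave r z x).fderiv]
  simp only [ContinuousLinearMap.comp_apply]
  congr 1
  simp [Pi.single_apply, apply_ite Complex.ofReal]
  ring

/-- The image of a plane wave under a real-linear functional. -/
noncomputable def wave (r : ℂ →L[ℝ] ℝ) (A : Amplitude) (Γ : ℂ) (k : Fin 3 → ℝ) :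
    FluidFields where
  ε x := r (phase Γ k x * A.1)
  n x := r (phase Γ k x * A.2.1)
  u x a := r (phase Γ k x * A.2.2 a)

theorem waveRe_eq (A : Amplitude) : waveRe A Γ k = wave Complex.reCLM A Γ k := rfl

theorem waveIm_eq (A : Amplitude) : waveIm A Γ k = wave Complex.imCLM A Γ k := rfl

/-- The jet of a plane wave at the origin. -/
noncomputable def waveJet (A : Amplitude) (Γ : ℂ) (k : Fin 3 → ℝ) : FluidJet ℂ where
  ε := A.1
  n := A.2.1
  u := A.2.2
  dε a := waveSymbol Γ k a * A.1
  dn a := waveSymbol Γ k a * A.2.1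
  du a b := waveSymbol Γ k a * A.2.2 b

/-- Since differentiation only multiplies by the symbol, the position enters through the phase
alone, and the fluxes are again plane waves. -/
theorem jet_wave (r : ℂ →L[ℝ] ℝ) (A : Amplitude) (x : Spacetime) :
    (wave r A Γ k).jet x
      = (waveJet A Γ k).map ((r : ℂ →ₗ[ℝ] ℝ) ∘ₗ LinearMap.mulLeft ℝ (phase Γ k x)) := by
  simp [FluidFields.jet, wave, pd_wave, FluidJet.map, waveJet]

end PlaneWave

namespace FluidModel

open FluidFields

variable {M : FluidModel} {p : ℝ × ℝ} {A : Amplitude} {Γ : ℂ} {k : Fin 3 → ℝ}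

/-- The divergence of a plane-wave flux is its contraction with the symbol; evaluation at the
origin, where the phase is `1`, extracts the amplitude. -/
theorem wave_equations (h : M.RegularAt p) (hT : M.T p ≠ 0) (hn : p.2 ≠ 0) (hρ : M.ρ p ≠ 0)
    {r : ℂ →L[ℝ] ℝ} (hs : M.IsLinearisedSolution (rest p) (wave r A Γ k)) :
    r (A.2.2 0) = 0 ∧
    r (∑ a, waveSymbol Γ k a * (waveJet A Γ k).current M p a) = 0 ∧
    ∀ b, r (∑ a, waveSymbol Γ k a * (waveJet A Γ k).stress M p a b) = 0 := by
  have dε : ∀ x, DifferentiableAt ℝ (wave r A Γ k).ε x :=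
    fun x => (hasFDerivAt_wave r _ x).differentiableAt
  have dn : ∀ x, DifferentiableAt ℝ (wave r A Γ k).n x :=
    fun x => (hasFDerivAt_wave r _ x).differentiableAt
  have du : ∀ x a, DifferentiableAt ℝ (fun y => (wave r A Γ k).u y a) x :=
    fun x a => (hasFDerivAt_wave r _ x).differentiableAt
  have hJ : ∀ a, M.δcurrent (rest p) (wave r A Γ k) a
      = fun x => r (phase Γ k x * (waveJet A Γ k).current M p a) := fun a => by
    ext x
    rw [δcurrent_rest h hT hρ (dε x) (dn x) (du x), jet_wave, FluidJet.current_map]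
    rfl
  have hS : ∀ a b, M.δstress (rest p) (wave r A Γ k) a b
      = fun x => r (phase Γ k x * (waveJet A Γ k).stress M p a b) := fun a b => by
    ext x
    rw [δstress_rest h hT hn (dε x) (dn x) (du x), jet_wave, FluidJet.stress_map]
    rfl
  refine ⟨?_, ?_, fun b => ?_⟩
  · have := hs.normalised 0
    simpa [Fin.sum_univ_four, uLow, rest, wave, phase_zero, minkowski, Matrix.diagonal_apply]
      using this
  · have := hs.charge 0
    simpa only [hJ, pd_wave, phase_zero, one_mul, ← map_sum] using this
  · have := hs.energy_momentum 0 b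
    simpa only [hS, pd_wave, phase_zero, one_mul, ← map_sum] using this

theorem IsMode.equations (h : M.RegularAt p) (hT : M.T p ≠ 0) (hn : p.2 ≠ 0) (hρ : M.ρ p ≠ 0)
    (hm : M.IsMode p A Γ k) :
    A.2.2 0 = 0 ∧
    ∑ a, waveSymbol Γ k a * (waveJet A Γ k).current M p a = 0 ∧
    ∀ b, ∑ a, waveSymbol Γ k a * (waveJet A Γ k).stress M p a b = 0 := by
  have h1 := wave_equations h hT hn hρ (waveRe_eq A ▸ hm.1)
  have h2 := wave_equations h hT hn hρ (waveIm_eq A ▸ hm.2)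
  exact ⟨Complex.ext h1.1 h2.1, Complex.ext h1.2.1 h2.2.1,
    fun b => Complex.ext (h1.2.2 b) (h2.2.2 b)⟩

theorem restU_eq : restU = ![1, 0, 0, 0] := by
  ext a
  fin_cases a <;> simp [restU]

theorem restProj_eq (a b : Fin 4) : restProj a b = Matrix.diagonal ![0, 1, 1, 1] a b := by
  fin_cases a <;> fin_cases b <;> simp [restProj, restU_eq, minkowski]

/-- The rest-frame projector annihilates the time index, so every summand vanishes. -/
theorem waveJet_shear_sum_zero :
    ∑ a, waveSymbol Γ k a * (waveJet A Γ k).shear a 0 = 0 := by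
  simp [FluidJet.shear, restShearCoeff, restProj_eq, Fin.sum_univ_four]

/-- The divergence of the linearised shear tensor of a plane wave. -/
theorem waveJet_shear_sum (hu : A.2.2 0 = 0) (i : Fin 3) :
    ∑ a, waveSymbol Γ k a * (waveJet A Γ k).shear a i.succ
      = -((∑ j, (k j : ℂ) ^ 2) * A.2.2 i.succ
        + 1 / 3 * k i * ∑ j, (k j : ℂ) * A.2.2 j.succ) / 2 := by
  simp only [FluidJet.shear, restShearCoeff, restProj_eq, minkowski, waveJet, waveSymbol,
    Fin.sum_univ_four, Fin.sum_univ_three]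
  fin_cases i <;> simp [hu] <;> ring_nf <;> simp only [Complex.I_sq] <;> ring

/-- The amplitude of a mode lies in the kernel of the dispersion matrix. -/
theorem IsMode.dispersionMatrix_mulVec (h : M.RegularAt p) (hT : M.T p ≠ 0) (hn : p.2 ≠ 0)
    (hρ : M.ρ p ≠ 0) (hm : M.IsMode p A Γ k) :
    (M.dispersionMatrix p Γ k).mulVec ![A.1, A.2.1, A.2.2 1, A.2.2 2, A.2.2 3] = 0 := by
  obtain ⟨hu, hJ, hS⟩ := hm.equations h hT hn hρ
  have hS0 := hS 0
  have hS1 := hS 1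
  have hS2 := hS 2
  have hS3 := hS 3
  have key0 := waveJet_shear_sum_zero (A := A) (k := k) (Γ := Γ)
  have key1 := waveJet_shear_sum (k := k) (Γ := Γ) hu 0
  have key2 := waveJet_shear_sum (k := k) (Γ := Γ) hu 1
  have key3 := waveJet_shear_sum (k := k) (Γ := Γ) hu 2
  simp only [FluidJet.current, FluidJet.stress, FluidJet.heat, FluidJet.div, Fin.sum_univ_four,
    Fin.sum_univ_three, restProj_eq, restU_eq, Complex.real_smul]
    at hJ hS0 hS1 hS2 hS3 key0 key1 key2 key3
  -- Only the divergence of the shear is needed, and `key0`–`key3` hold it; keeping the tensor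
  -- opaque avoids expanding it.
  generalize (waveJet A Γ k).shear = S at *
  simp [waveJet, waveSymbol, hu] at hJ hS0 hS1 hS2 hS3 key0 key1 key2 key3
  ext i
  fin_cases i
  · simp [dispersionMatrix, Matrix.mulVec, dotProduct, Fin.sum_univ_succ]
    linear_combination (norm := (ring_nf; simp only [Complex.I_sq]; ring)) hJ
  · simp [dispersionMatrix, Matrix.mulVec, dotProduct, Fin.sum_univ_succ]
    linear_combination (norm := (ring_nf; simp only [Complex.I_sq]; ring))
      hS0 + 2 * M.η p * key0
  · simp [dispersionMatrix, Matrix.mulVec, dotProduct, Fin.sum_univ_succ]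
    linear_combination (norm := (ring_nf; simp only [Complex.I_sq]; ring))
      hS1 + 2 * M.η p * key1
  · simp [dispersionMatrix, Matrix.mulVec, dotProduct, Fin.sum_univ_succ]
    linear_combination (norm := (ring_nf; simp only [Complex.I_sq]; ring))
      hS2 + 2 * M.η p * key2
  · simp [dispersionMatrix, Matrix.mulVec, dotProduct, Fin.sum_univ_succ]
    linear_combination (norm := (ring_nf; simp only [Complex.I_sq]; ring))
      hS3 + 2 * M.η p * key3

/-- Normalisation already gives `δu⁰ = 0`, so a nonzero amplitude has a nonzero entry among the five
on which the matrix acts. -/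
theorem IsMode.det_dispersionMatrix_eq_zero (h : M.RegularAt p) (hT : M.T p ≠ 0) (hn : p.2 ≠ 0)
    (hρ : M.ρ p ≠ 0) (hA : A ≠ 0) (hm : M.IsMode p A Γ k) :
    (M.dispersionMatrix p Γ k).det = 0 := by
  refine Matrix.exists_mulVec_eq_zero_iff.1 ⟨_, fun h0 => hA ?_,
    hm.dispersionMatrix_mulVec h hT hn hρ⟩
  have hu := (hm.equations h hT hn hρ).1
  simp at h0
  obtain ⟨h1, h2, h3, h4, h5⟩ := h0
  refine Prod.ext h1 (Prod.ext h2 (funext fun a => ?_))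
  fin_cases a
  exacts [hu, h3, h4, h5]

end FluidModel

/-! ### The stability theorem -/

theorem lemma5 (M : FluidModel) (ε n : ℝ)
    (hreg : M.RegularAt (ε, n))
    (hn : 0 < n) (hT : 0 < M.T (ε, n)) (hρ : 0 < M.ρ (ε, n))
    (hσ : 0 ≤ M.σ (ε, n) + M.σ₀ (ε, n)) (hη : 0 ≤ M.η (ε, n))
    (hD : 0 ≤ M.D (ε, n)) (hs₂ : 0 < M.s₂ (ε, n)) (hcs : 0 ≤ M.csSq (ε, n))
    (hτn : 0 < M.τn (ε, n)) (hτε : 0 < M.τε (ε, n)) (hτQ : 0 < M.τQ (ε, n))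
    (hH : ∀ k : ℝ, 0 ≤ k → ∀ (m : ℕ) (_ : 2 ≤ m) (hm : m ≤ 5),
      0 ≤ (M.H (ε, n) k m (hm.trans (by norm_num))).det) :
    M.LinearlyStable (ε, n) ∧
    (∀ (Γ : ℂ) (k : Fin 3 → ℝ),
      (M.dispersionMatrix (ε, n) Γ k).det =
        -(M.shearPoly (ε, n) Γ (Real.sqrt (∑ i, k i ^ 2))) ^ 2
          * M.soundPoly (ε, n) Γ (Real.sqrt (∑ i, k i ^ 2))) ∧
    (∀ k : ℝ, M.a (ε, n) k 0 =
      (M.σ (ε, n) + M.σ₀ (ε, n)) * M.ρ (ε, n) * M.s₂ (ε, n) * k ^ 4 + M.D (ε, n) * k ^ 6 ∧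
      0 ≤ M.a (ε, n) k 0) := by
  have ha0 := M.a_zero_eq (p := (ε, n)) hn hρ
  have ha0' : ∀ k : ℝ, 0 ≤ M.a (ε, n) k 0 := fun k => by
    rw [ha0]
    have : 0 ≤ k ^ 6 := by positivity
    positivity
  have hdet : ∀ (Γ : ℂ) (k : Fin 3 → ℝ), (M.dispersionMatrix (ε, n) Γ k).det =
      -(M.shearPoly (ε, n) Γ (Real.sqrt (∑ i, k i ^ 2))) ^ 2
        * M.soundPoly (ε, n) Γ (Real.sqrt (∑ i, k i ^ 2)) := fun Γ k =>
    M.det_dispersionMatrix hρ Γ (Real.sq_sqrt (Finset.sum_nonneg fun i _ => sq_nonneg (k i)))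
  refine ⟨fun k Γ A hA hm => ?_, hdet, fun k => ⟨ha0 k, ha0' k⟩⟩
  have h0 := hm.det_dispersionMatrix_eq_zero hreg hT.ne' hn.ne' hρ.ne' hA
  rw [hdet, neg_mul, neg_eq_zero, mul_eq_zero, sq_eq_zero_iff] at h0
  rcases h0 with h0 | h0
  · exact M.re_nonpos_of_shearPoly_eq_zero hρ hη hτQ h0
  · exact M.re_nonpos_of_soundPoly_eq_zero hρ hcs hτn hτε hτQ ha0' hH h0
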